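/- An $s$-stage Runge--Kutta--Nyström (RKN) method $(\bar A,\bar b,b,c)$ for $q''=f(t,q)$, $q(t_0)=q_0$, $q'(t_0)=q_0'$, $q\in\mathbb R^d$, is the one-step method $$Q_i=q_0+hc_iq_0'+h^2\sum_{j=1}^s\bar a_{ij}f(t_0+c_jh,Q_j),\quad q_1=q_0+hq_0'+h^2\sum_{i=1}^s\bar b_if(t_0+c_ih,Q_i),\quad q_1'=q_0'+h\sum_{i=1}^sb_if(t_0+c_ih,Q_i).$$ For small $h$ the stages $Q_i$ are the solution of the stage equations near $q_0$. The method has order $p$ if for every sufficiently smooth problem (that is, $f$ of class $C^N$ near $(t_0,q_0)$, for some $N$ depending only on the method and $p$) the stage equations have, for all small $|h|$, exactly one solution near $q_0$, and $q(t_0+h)-q_1=\mathcal O(h^{p+1})$, $q'(t_0+h)-q_1'=\mathcal O(h^{p+1})$ as $h\to0$. For a separable Hamiltonian $H(p,q)=\tfrac12p^TMp+V(q)$ with $M$ a constant symmetric (possibly singular) matrix, the system is $p'=-\nabla V(q)$, $q'=Mp$, so $q''=-M\nabla V(q)$; the method is applied with $f(q)=-M\nabla V(q)$, $q_0'=Mp_0$,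 and the last formula replaced by $p_1=p_0-h\sum_ib_i\nabla V(Q_i)$. It is called symplectic if, for all $d$, all such $M$ and all $V$ of class $C^2$ on an open subset of $\mathbb R^d$: (i) for every step size $h$, wherever the stages are given on an open set of phase space by a differentiable solution of the stage equations, the map $(p_0,q_0)\mapsto(p_1,q_1)$ is differentiable and satisfies $dp_1\wedge dq_1=dp_0\wedge dq_0$; (ii) near every phase point and for all small $|h|$ such a differentiable solution exists and is the only one with stages near $q_0$. Let $P_n(t)=\frac{\sqrt{2n+1}}{n!}\frac{d^n}{dt^n}(t^2-t)^n$ be the normalized shifted Legendre polynomials, $\xi_n=\frac1{2\sqrt{4n^2-1}}$, and for $k\in\{2,3,4\}$ and $\theta\in\mathbb R$ let $$\begin{aligned}\bar A^{(k,\theta)}_{\tau,\sigma}={}&\tfrac16-\tfrac12\xi_1P_1(\sigma)+\tfrac12\xi_1P_1(\tau)+\sum_{n=1}^{k-1}\xi_n\xi_{n+1}\big(P_{n-1}(\tau)P_{n+1}(\sigma)+P_{n+1}(\tau)P_{n-1}(\sigma)\big)\\&-\sum_{n=1}^{k-2}(\xi_n^2+\xi_{n+1}^2)P_n(\tau)P_n(\sigma)+\theta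 P_{k-1}(\tau)P_{k-1}(\sigma).\end{aligned}$$ **Claim.** For every $\theta\in\mathbb R$ and each of the three RKN methods below, with $k=2,3,4$ stages respectively: $(b_i,c_i)$ is the $k$-point Gauss quadrature on $[0,1]$ (increasing nodes, exact for polynomials of degree less than $2k$), $\bar a_{ij}=b_j\bar A^{(k,\theta)}_{c_i,c_j}$ and $\bar b_i=b_i(1-c_i)$; the method is symplectic for separable Hamiltonians; it has order $2k$, i.e. $4,6,8$ respectively; and its version for separable Hamiltonian systems has order $2k$ as well: for $V$ sufficiently smooth near $q_0$, with stages as in the definition of order, $p(h)-p_1=\mathcal O(h^{2k+1})$ and $q(h)-q_1=\mathcal O(h^{2k+1})$ for the solution of $p'=-\nabla V(q)$, $q'=Mp$ starting at $(p_0,q_0)$ at time $0$. *Two stages:* $$\bar A=\begin{pmatrix}\frac{1+6\theta}{12}&\frac{1-\sqrt3-6\theta}{12}\\ \frac{1+\sqrt3-6\theta}{12}&\frac{1+6\theta}{12}\end{pmatrix},\quad\bar b=\Big(\tfrac{3+\sqrt3}{12},\tfrac{3-\sqrt3}{12}\Big),\quad b=\Big(\tfrac12,\tfrac12\Big),\quad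 c=\Big(\tfrac{3-\sqrt3}6,\tfrac{3+\sqrt3}6\Big).$$ *Three stages:* $$\bar A=\begin{pmatrix}\frac{2+30\theta}{135}&\frac{19-6\sqrt{15}-120\theta}{270}&\frac{62-15\sqrt{15}+120\theta}{540}\\ \frac{19+6\sqrt{15}-120\theta}{432}&\frac{1+15\theta}{27}&\frac{19-6\sqrt{15}-120\theta}{432}\\ \frac{62+15\sqrt{15}+120\theta}{540}&\frac{19+6\sqrt{15}-120\theta}{270}&\frac{2+30\theta}{135}\end{pmatrix},$$ $$\bar b=\Big(\tfrac{5+\sqrt{15}}{36},\tfrac29,\tfrac{5-\sqrt{15}}{36}\Big),\quad b=\Big(\tfrac5{18},\tfrac49,\tfrac5{18}\Big),\quad c=\Big(\tfrac{5-\sqrt{15}}{10},\tfrac12,\tfrac{5+\sqrt{15}}{10}\Big).$$ *Four stages:* with $x=\sqrt{30}$, $y=\sqrt{14}$, $z=\sqrt{105}$, $u=\sqrt{630+84\sqrt{30}}$, $w=\sqrt{630-84\sqrt{30}}$, $m=\sqrt{525+70\sqrt{30}}$, $n=\sqrt{525-70\sqrt{30}}$, $$b=\Big(\tfrac14-\tfrac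 x{72},\tfrac14+\tfrac x{72},\tfrac14+\tfrac x{72},\tfrac14-\tfrac x{72}\Big),\quad c=\Big(\tfrac{35-m}{70},\tfrac{35-n}{70},\tfrac{35+n}{70},\tfrac{35+m}{70}\Big),$$ $$\bar b=\Big(-\tfrac x{144}-\tfrac u{1008}+\tfrac18+\tfrac m{280},\ \tfrac x{144}+\tfrac w{1008}+\tfrac18+\tfrac n{280},\ \tfrac x{144}-\tfrac w{1008}+\tfrac18-\tfrac n{280},\ -\tfrac x{144}+\tfrac u{1008}+\tfrac18-\tfrac m{280}\Big),$$ and $\bar A$ has the entries $$\begin{aligned} \bar a_{11}=\bar a_{44}&=\tfrac{3}{280}-\tfrac{3x}{2800}+\tfrac{(10-x)\theta}{40},\qquad \bar a_{22}=\bar a_{33}=\tfrac{3}{280}+\tfrac{3x}{2800}+\tfrac{(10+x)\theta}{40},\\ \bar a_{12}&=\tfrac{3}{56}+\tfrac{x}{336}+\tfrac{-u+w}{2016}-\tfrac{y}{490}-\tfrac{y\theta}{56}+\tfrac{-m+n}{560}-\tfrac{3z}{1225}-\tfrac{3z\theta}{140},\\ \bar a_{13}&=\tfrac{3}{56}+\tfrac{x}{336}-\tfrac{u+w}{2016}+\tfrac{y}{490}+\tfrac{y\theta}{56}-\tfrac{m+n}{560}+\tfrac{3z}{1225}+\tfrac{3z\theta}{140},\\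 \bar a_{14}&=\tfrac{17}{280}+\tfrac{19x}{8400}+\tfrac{u}{1008}+\tfrac{(x-10)\theta}{40}-\tfrac{m}{280},\\ \bar a_{21}&=\tfrac{3}{56}-\tfrac{x}{336}+\tfrac{w-u}{2016}+\tfrac{y}{490}+\tfrac{y\theta}{56}+\tfrac{m-n}{560}-\tfrac{3z}{1225}-\tfrac{3z\theta}{140},\\ \bar a_{23}&=\tfrac{17}{280}-\tfrac{19x}{8400}-\tfrac{w}{1008}-\tfrac{(x+10)\theta}{40}-\tfrac{n}{280},\\ \bar a_{24}&=\tfrac{3}{56}-\tfrac{x}{336}+\tfrac{u+w}{2016}-\tfrac{y}{490}-\tfrac{y\theta}{56}-\tfrac{m+n}{560}+\tfrac{3z}{1225}+\tfrac{3z\theta}{140},\\ \bar a_{31}&=\tfrac{3}{56}-\tfrac{x}{336}-\tfrac{u+w}{2016}-\tfrac{y}{490}-\tfrac{y\theta}{56}+\tfrac{m+n}{560}+\tfrac{3z}{1225}+\tfrac{3z\theta}{140},\\ \bar a_{32}&=\tfrac{17}{280}-\tfrac{19x}{8400}+\tfrac{w}{1008}-\tfrac{(x+10)\theta}{40}+\tfrac{n}{280},\\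 \bar a_{34}&=\tfrac{3}{56}-\tfrac{x}{336}+\tfrac{u-w}{2016}+\tfrac{y}{490}+\tfrac{y\theta}{56}+\tfrac{n-m}{560}-\tfrac{3z}{1225}-\tfrac{3z\theta}{140},\\ \bar a_{41}&=\tfrac{17}{280}+\tfrac{19x}{8400}-\tfrac{u}{1008}+\tfrac{(x-10)\theta}{40}+\tfrac{m}{280},\\ \bar a_{42}&=\tfrac{3}{56}+\tfrac{x}{336}+\tfrac{u+w}{2016}+\tfrac{y}{490}+\tfrac{y\theta}{56}+\tfrac{m+n}{560}+\tfrac{3z}{1225}+\tfrac{3z\theta}{140},\\ \bar a_{43}&=\tfrac{3}{56}+\tfrac{x}{336}+\tfrac{u-w}{2016}-\tfrac{y}{490}-\tfrac{y\theta}{56}+\tfrac{m-n}{560}-\tfrac{3z}{1225}-\tfrac{3z\theta}{140}. \end{aligned}$$ -/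

import Mathlib

open scoped Topology Polynomial

noncomputable section

/-- The phase space factor `ℝ^d` with its Euclidean norm. -/
abbrev Vec (d : ℕ) : Type := EuclideanSpace ℝ (Fin d)

/-- The coefficients `(Ā, b̄, b, c)` of an `s`-stage Runge-Kutta-Nyström method. -/
structure RKNMethod (s : ℕ) where
  A : Matrix (Fin s) (Fin s) ℝ
  bbar : Fin s → ℝ
  b : Fin s → ℝ
  c : Fin s → ℝ

namespace RKNMethod

variable {s : ℕ} (T : RKNMethod s) {d : ℕ}

/-- `Q` solves the stage equations for `q'' = f(t, q)`, `q(t₀) = q₀`, `q'(t₀) = v₀`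
with step size `h`. -/
def IsStages (f : ℝ → Vec d → Vec d) (t₀ : ℝ) (q₀ v₀ : Vec d) (h : ℝ)
    (Q : Fin s → Vec d) : Prop :=
  ∀ i, Q i = q₀ + (h * T.c i) • v₀ + h ^ 2 • ∑ j, T.A i j • f (t₀ + T.c j * h) (Q j)

/-- The new position `q₁` computed from the stages. -/
def nextPos (f : ℝ → Vec d → Vec d) (t₀ : ℝ) (q₀ v₀ : Vec d) (h : ℝ)
    (Q : Fin s → Vec d) : Vec d :=
  q₀ + h • v₀ + h ^ 2 • ∑ i, T.bbar i • f (t₀ + T.c i * h) (Q i)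

/-- The new velocity `q'₁` computed from the stages. -/
def nextVel (f : ℝ → Vec d → Vec d) (t₀ : ℝ) (v₀ : Vec d) (h : ℝ)
    (Q : Fin s → Vec d) : Vec d :=
  v₀ + h • ∑ i, T.b i • f (t₀ + T.c i * h) (Q i)

/-- Order `p`: for every sufficiently smooth problem (of class `C^N` near the initial point, with
`N` depending only on the method) and every exact solution `q` with velocity `v`, the stage
equations have, for small `h`, exactly one solution near `q₀`, and the resulting step satisfies
`q(t₀+h) - q₁ = O(h^(p+1))` and `q'(t₀+h) - q'₁ = O(h^(p+1))`. -/
def HasOrder (p : ℕ) : Prop :=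
  ∃ N : ℕ, ∀ (d : ℕ) (f : ℝ → Vec d → Vec d) (t₀ : ℝ) (q₀ v₀ : Vec d),
    ContDiffAt ℝ N (fun x : ℝ × Vec d => f x.1 x.2) (t₀, q₀) →
    ∀ q v : ℝ → Vec d, q t₀ = q₀ → v t₀ = v₀ →
      (∀ᶠ t in 𝓝 t₀, HasDerivAt q (v t) t ∧ HasDerivAt v (f t (q t)) t) →
      ∃ r > 0, ∃ h₀ > 0, ∃ C : ℝ, ∀ h : ℝ, |h| < h₀ →
        (∃! Q : Fin s → Vec d, (∀ i, ‖Q i - q₀‖ < r) ∧ T.IsStages f t₀ q₀ v₀ h Q) ∧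
        ∀ Q : Fin s → Vec d, (∀ i, ‖Q i - q₀‖ < r) → T.IsStages f t₀ q₀ v₀ h Q →
          ‖q (t₀ + h) - T.nextPos f t₀ q₀ v₀ h Q‖ ≤ C * |h| ^ (p + 1) ∧
          ‖v (t₀ + h) - T.nextVel f t₀ v₀ h Q‖ ≤ C * |h| ^ (p + 1)

/-- The stage equations for the separable Hamiltonian `H(p, q) = ½ pᵀ M p + V(q)`, that is for
`q'' = -M ∇V(q)` with initial velocity `M p₀`. The phase point is `z = (p₀, q₀)`. -/
def IsHamStages (M : Matrix (Fin d) (Fin d) ℝ) (V : Vec d → ℝ) (h : ℝ)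
    (z : Vec d × Vec d) (Q : Fin s → Vec d) : Prop :=
  T.IsStages (fun _ q => -M.toEuclideanLin (gradient V q)) 0 z.2 (M.toEuclideanLin z.1) h Q

/-- The step `(p₀, q₀) ↦ (p₁, q₁)` for the separable Hamiltonian, computed from the stages. The
momentum update uses `-∇V` (no factor `M`), so that `M` need not be invertible. -/
def hamStep (M : Matrix (Fin d) (Fin d) ℝ) (V : Vec d → ℝ) (h : ℝ)
    (z : Vec d × Vec d) (Q : Fin s → Vec d) : Vec d × Vec d :=
  (z.1 + h • ∑ i, T.b i • (-gradient V (Q i)),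
    T.nextPos (fun _ q => -M.toEuclideanLin (gradient V q)) 0 z.2 (M.toEuclideanLin z.1) h Q)

/-- Order `p` of the step `(p₀, q₀) ↦ (p₁, q₁)` for the Hamiltonian systems
`p' = -∇V(q)`, `q' = M p`. -/
def HasHamOrder (p : ℕ) : Prop :=
  ∃ N : ℕ, ∀ (d : ℕ) (M : Matrix (Fin d) (Fin d) ℝ), M.IsSymm →
    ∀ (V : Vec d → ℝ) (z₀ : Vec d × Vec d), ContDiffAt ℝ N V z₀.2 →
    ∀ P q : ℝ → Vec d, P 0 = z₀.1 → q 0 = z₀.2 →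
      (∀ᶠ t in 𝓝 (0 : ℝ), HasDerivAt P (-gradient V (q t)) t ∧
        HasDerivAt q (M.toEuclideanLin (P t)) t) →
      ∃ r > 0, ∃ h₀ > 0, ∃ C : ℝ, ∀ h : ℝ, |h| < h₀ →
        (∃! Q : Fin s → Vec d, (∀ i, ‖Q i - z₀.2‖ < r) ∧ T.IsHamStages M V h z₀ Q) ∧
        ∀ Q : Fin s → Vec d, (∀ i, ‖Q i - z₀.2‖ < r) → T.IsHamStages M V h z₀ Q →
          ‖P h - (T.hamStep M V h z₀ Q).1‖ ≤ C * |h| ^ (p + 1) ∧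
          ‖q h - (T.hamStep M V h z₀ Q).2‖ ≤ C * |h| ^ (p + 1)

end RKNMethod

/-- The canonical two-form `dp ∧ dq = ∑ dpᵢ ∧ dqᵢ` on `(p, q)`-space. -/
def canonicalForm {d : ℕ} (u w : Vec d × Vec d) : ℝ :=
  ∑ i, (u.1 i * w.2 i - w.1 i * u.2 i)

/-- `Φ` is differentiable on the open set `D` and preserves `dp ∧ dq` there. -/
def IsSymplecticMapOn {d : ℕ} (Φ : Vec d × Vec d → Vec d × Vec d)
    (D : Set (Vec d × Vec d)) : Prop :=
  ∀ z ∈ D, DifferentiableAt ℝ Φ z ∧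
    ∀ u w, canonicalForm (fderiv ℝ Φ z u) (fderiv ℝ Φ z w) = canonicalForm u w

namespace RKNMethod

variable {s : ℕ} (T : RKNMethod s)

/-- Symplecticity for separable Hamiltonians `½ pᵀ M p + V(q)`, with `M` symmetric (possibly
singular) and `V` of class `C²` on an open set `W`.
* Whenever the stages are given on an open set `D` of phase space by a differentiable solution
  `Q` of the stage equations, the step map is symplectic on `D`, for every step size `h`.
* Near every phase point and for all small `h` there is such a solution, and it is
  the only one with stages near `q₀`. -/
def IsSymplectic : Prop :=
  ∀ (d : ℕ) (M : Matrix (Fin d) (Fin d) ℝ), M.IsSymm →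
    ∀ (V : Vec d → ℝ) (W : Set (Vec d)), IsOpen W → ContDiffOn ℝ 2 V W →
      (∀ (h : ℝ) (D : Set (Vec d × Vec d)), IsOpen D →
        ∀ Q : Vec d × Vec d → Fin s → Vec d, DifferentiableOn ℝ Q D →
          (∀ z ∈ D, (∀ i, Q z i ∈ W) ∧ T.IsHamStages M V h z (Q z)) →
          IsSymplecticMapOn (fun z => T.hamStep M V h z (Q z)) D) ∧
      (∀ z₀ : Vec d × Vec d, z₀.2 ∈ W → ∃ r > 0, ∃ h₀ > 0, ∃ D : Set (Vec d × Vec d),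
        IsOpen D ∧ z₀ ∈ D ∧ Metric.ball z₀.2 r ⊆ W ∧
        ∀ h : ℝ, |h| < h₀ → ∃ Q : Vec d × Vec d → Fin s → Vec d, DifferentiableOn ℝ Q D ∧
          ∀ z ∈ D, (∀ i, Q z i ∈ Metric.ball z₀.2 r) ∧ T.IsHamStages M V h z (Q z) ∧
            ∀ Q' : Fin s → Vec d, (∀ i, Q' i ∈ Metric.ball z₀.2 r) →
              T.IsHamStages M V h z Q' → Q' = Q z)

/-- `(bᵢ, cᵢ)` is the `s`-point Gauss quadrature on `[0, 1]`: increasing nodes, exact on all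
polynomials of degree less than `2s`. -/
def IsGauss : Prop :=
  StrictMono T.c ∧ ∀ g : ℝ[X], g.natDegree < 2 * s →
    ∑ i, T.b i * g.eval (T.c i) = ∫ x in (0 : ℝ)..1, g.eval x

end RKNMethod

/-- Normalized shifted Legendre polynomial, by the Rodrigues formula. -/
def legendreP (n : ℕ) : ℝ[X] :=
  Polynomial.C (√(2 * n + 1) / n.factorial) *
    Polynomial.derivative^[n] ((Polynomial.X ^ 2 - Polynomial.X) ^ n)

/-- `ξ_n = 1 / (2 √(4n² - 1))`, used for `n ≥ 1`. -/
def legendreXi (n : ℕ) : ℝ := 1 / (2 * √(4 * (n : ℝ) ^ 2 - 1))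

/-- The continuous-stage coefficient `Ā(τ, σ)` with `η = ζ = k ≥ 2` and the single free parameter
`θ` in front of `P_{k-1}(τ) P_{k-1}(σ)`. -/
def csCoeff (k : ℕ) (θ τ σ : ℝ) : ℝ :=
  1 / 6 - 1 / 2 * legendreXi 1 * (legendreP 1).eval σ
    + 1 / 2 * legendreXi 1 * (legendreP 1).eval τ
    + ∑ n ∈ Finset.Icc 1 (k - 1), legendreXi n * legendreXi (n + 1) *
        ((legendreP (n - 1)).eval τ * (legendreP (n + 1)).eval σ)
    - ∑ n ∈ Finset.Icc 1 (k - 2), (legendreXi n ^ 2 + legendreXi (n + 1) ^ 2) *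
        ((legendreP n).eval τ * (legendreP n).eval σ)
    + ∑ n ∈ Finset.Icc 1 (k - 1), legendreXi n * legendreXi (n + 1) *
        ((legendreP (n + 1)).eval τ * (legendreP (n - 1)).eval σ)
    + θ * ((legendreP (k - 1)).eval τ * (legendreP (k - 1)).eval σ)

/-- `T` is obtained from the continuous-stage method with coefficients `Ā(τ, σ)`,
`B̄(τ) = 1 - τ`, `B(τ) = 1`, `C(τ) = τ` by Gauss quadrature. -/
def RKNMethod.IsGaussDiscretization {s : ℕ} (T : RKNMethod s) (Abar : ℝ → ℝ → ℝ) : Prop :=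
  T.IsGauss ∧ (∀ i j, T.A i j = T.b j * Abar (T.c i) (T.c j)) ∧
    ∀ i, T.bbar i = T.b i * (1 - T.c i)

/-- The 2-stage family. -/
def family4 (θ : ℝ) : RKNMethod 2 where
  A := !![(1 + 6 * θ) / 12, (1 - √3 - 6 * θ) / 12;
          (1 + √3 - 6 * θ) / 12, (1 + 6 * θ) / 12]
  bbar := ![(3 + √3) / 12, (3 - √3) / 12]
  b := ![1 / 2, 1 / 2]
  c := ![(3 - √3) / 6, (3 + √3) / 6]

/-- The 3-stage family. -/
def family6 (θ : ℝ) : RKNMethod 3 where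
  A := !![(2 + 30 * θ) / 135, (19 - 6 * √15 - 120 * θ) / 270,
            (62 - 15 * √15 + 120 * θ) / 540;
          (19 + 6 * √15 - 120 * θ) / 432, (1 + 15 * θ) / 27,
            (19 - 6 * √15 - 120 * θ) / 432;
          (62 + 15 * √15 + 120 * θ) / 540, (19 + 6 * √15 - 120 * θ) / 270,
            (2 + 30 * θ) / 135]
  bbar := ![(5 + √15) / 36, 2 / 9, (5 - √15) / 36]
  b := ![5 / 18, 4 / 9, 5 / 18]
  c := ![(5 - √15) / 10, 1 / 2, (5 + √15) / 10]

/-- The 4-stage family. -/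
def family8 (θ : ℝ) : RKNMethod 4 :=
  let x := √30
  let y := √14
  let z := √105
  let u := √(630 + 84 * √30)
  let w := √(630 - 84 * √30)
  let m := √(525 + 70 * √30)
  let n := √(525 - 70 * √30)
  { A := !![
      -(3 * x / 2800) + 3 / 280 - x * θ / 40 + θ / 4,
      x / 336 - u / 2016 + w / 2016 - y / 490 - y * θ / 56 + 3 / 56 - m / 560 + n / 560
        - 3 * z / 1225 - 3 * z * θ / 140,
      x / 336 - u / 2016 - w / 2016 + y / 490 + y * θ / 56 + 3 / 56 - m / 560 - n / 560
        + 3 * z / 1225 + 3 * z * θ / 140,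
      19 * x / 8400 + u / 1008 + 17 / 280 + x * θ / 40 - θ / 4 - m / 280;
      -(x / 336) + w / 2016 - u / 2016 + y / 490 + y * θ / 56 + 3 / 56 - n / 560 + m / 560
        - 3 * z / 1225 - 3 * z * θ / 140,
      3 * x / 2800 + 3 / 280 + x * θ / 40 + θ / 4,
      -(19 * x / 8400) - w / 1008 + 17 / 280 - x * θ / 40 - θ / 4 - n / 280,
      -(x / 336) + u / 2016 + w / 2016 - y / 490 - y * θ / 56 + 3 / 56 - m / 560 - n / 560
        + 3 * z / 1225 + 3 * z * θ / 140;
      -(x / 336) - w / 2016 - u / 2016 - y / 490 - y * θ / 56 + 3 / 56 + 3 * z / 1225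
        + n / 560 + m / 560 + 3 * z * θ / 140,
      -(19 * x / 8400) - x * θ / 40 + w / 1008 + (17 - 70 * θ + n) / 280,
      (3 * x + 30) / 2800 + (x + 10) / 40 * θ,
      -(x / 336) + (u - w) / 2016 + y / 490 - 3 * z / 1225 - 3 * z * θ / 140
        + (10 * y * θ + 30 + n - m) / 560;
      -(u / 1008) + 19 * x / 8400 + (x - 10) / 40 * θ + (17 + m) / 280,
      x / 336 + y / 490 + (y * θ + 3) / 56 + (w + u) / 2016 + (n + m) / 560
        + 3 * z / 1225 + 3 * z * θ / 140,
      (x + 18 - 6 * y * θ) / 336 + (u - w) / 2016 - y / 490 + (m - n) / 560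
        - 3 * z / 1225 - 3 * z * θ / 140,
      (30 - 3 * x) / 2800 + (10 - x) / 40 * θ]
    bbar := ![
      -(x / 144) - u / 1008 + 1 / 8 + m / 280,
      x / 144 + w / 1008 + 1 / 8 + n / 280,
      x / 144 - w / 1008 + 1 / 8 - n / 280,
      -(x / 144) + u / 1008 + 1 / 8 - m / 280]
    b := ![-(x / 72) + 1 / 4, x / 72 + 1 / 4, x / 72 + 1 / 4, -(x / 72) + 1 / 4]
    c := ![(35 - m) / 70, (35 - n) / 70, (35 + n) / 70, (35 + m) / 70] }

end

/-! Symplecticity and order both follow from properties of the kernel `Ā(τ, σ)`.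

Symplecticity. A method with `b̄ᵢ = bᵢ(1 - cᵢ)` and `bᵢ(b̄ⱼ - āᵢⱼ) = bⱼ(b̄ᵢ - āⱼᵢ)` preserves `dp ∧
dq`: differentiate the stage equations and use the symmetry of `M` and of the Hessian of `V`
(`RKNMethod.canonicalForm_step_eq`). When `āᵢⱼ = bⱼ Ā(cᵢ, cⱼ)` the second condition follows from
`Ā(τ, σ) - Ā(σ, τ) = τ - σ`, which all three kernels satisfy.

Order. Twofold integration from `0` has the kernel `(τ - σ)₊`. In its Legendre expansion, the terms
in `P_n(σ)` with `n ≤ k - 2` are exactly those of `Ā`; the parameter `θ` only enters through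
`P_{k-1}(σ)`. Hence `∫ Ā(τ, σ) σ^r dσ = τ^(r+2) / ((r+1)(r+2))` for `r ≤ k - 2`. Since `Ā` has
degree at most `k` in `σ`, Gauss quadrature evaluates these integrals exactly and yields the stage
conditions; antisymmetry of `Ā` turns them into the adjoint conditions.

These simplifying conditions give order `2k` by superconvergence. The stages themselves are only
accurate to `O(h^(k+1))` (`isBigO_stage_error`), but their weighted means `∑ bᵢ cᵢ^m eᵢ` are
`O(h^(2k-m))` (`isBigO_weighted_stage_error`), and after linearization only such means enter the
update formulas. The quadrature error is `O(h^(2k+1))` as well.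

What remains is to check that the explicit tables are the Gauss discretizations of `Ā`. Solvability
of the stage equations for small `h` is the implicit function theorem. -/

/-! ### Solvability of the stage equations -/

/-- Near `h = 0`, `Q = (q̄, …, q̄)` the stage equations are solved by a `C¹` function of
`(h, q₀, v₀)`, and by nothing else. -/
theorem RKNMethod.exists_stages {s d : ℕ} (T : RKNMethod s) {f : ℝ → Vec d → Vec d} {t₀ : ℝ}
    {q₀ : Vec d} (v₀ : Vec d) (hf : ContDiffAt ℝ 1 (fun x : ℝ × Vec d => f x.1 x.2) (t₀, q₀)) :
    ∃ φ : ℝ × Vec d × Vec d → Fin s → Vec d,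
      ContDiffAt ℝ 1 φ (0, q₀, v₀) ∧ φ (0, q₀, v₀) = (fun _ => q₀) ∧
      ∀ᶠ p : (ℝ × Vec d × Vec d) × (Fin s → Vec d) in 𝓝 ((0, q₀, v₀), fun _ => q₀),
        T.IsStages f t₀ p.1.2.1 p.1.2.2 p.1.1 p.2 ↔ φ p.1 = p.2 := by
  let F : (ℝ × Vec d × Vec d) × (Fin s → Vec d) → (Fin s → Vec d) := fun p i =>
    p.2 i - (p.1.2.1 + (p.1.1 * T.c i) • p.1.2.2
      + p.1.1 ^ 2 • ∑ j, T.A i j • f (t₀ + T.c j * p.1.1) (p.2 j))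
  let u : (ℝ × Vec d × Vec d) × (Fin s → Vec d) := ((0, q₀, v₀), fun _ => q₀)
  have hfj : ∀ j, ContDiffAt ℝ 1 (fun p : (ℝ × Vec d × Vec d) × (Fin s → Vec d) =>
      f (t₀ + T.c j * p.1.1) (p.2 j)) u := by
    intro j
    exact ContDiffAt.comp (g := fun x : ℝ × Vec d => f x.1 x.2)
      (f := fun p : (ℝ × Vec d × Vec d) × (Fin s → Vec d) => (t₀ + T.c j * p.1.1, p.2 j)) u
      (by simpa [u] using hf) (by fun_prop)
  have hF : ContDiffAt ℝ 1 F u := by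
    rw [contDiffAt_pi]
    intro i
    have hsum : ContDiffAt ℝ 1 (fun p : (ℝ × Vec d × Vec d) × (Fin s → Vec d) =>
        ∑ j, T.A i j • f (t₀ + T.c j * p.1.1) (p.2 j)) u :=
      ContDiffAt.sum fun j _ => (hfj j).const_smul (T.A i j)
    have hpow : ContDiffAt ℝ 1 (fun p : (ℝ × Vec d × Vec d) × (Fin s → Vec d) => p.1.1 ^ 2) u := by
      fun_prop
    refine ContDiffAt.sub (by fun_prop) (ContDiffAt.add (by fun_prop) ?_)
    exact hpow.smul hsum
  have hFu : F u = 0 := by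
    funext i
    simp [F, u]
  -- At `h = 0` the equations decouple to `Q - q₀ = 0`, so the partial derivative in `Q` is the
  -- identity.
  have hinr : fderiv ℝ F u ∘L .inr ℝ (ℝ × Vec d × Vec d) (Fin s → Vec d) = .id ℝ _ := by
    have h1 : HasFDerivAt (fun Q : Fin s → Vec d => F ((0, q₀, v₀), Q))
        (fderiv ℝ F u ∘L .inr ℝ (ℝ × Vec d × Vec d) (Fin s → Vec d)) (fun _ => q₀) :=
      HasFDerivAt.comp (g := F) _ (hF.differentiableAt one_ne_zero).hasFDerivAt
        (hasFDerivAt_prodMk_right _ _)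
    have h2 : HasFDerivAt (fun Q : Fin s → Vec d => F ((0, q₀, v₀), Q))
        (.id ℝ _) (fun _ => q₀) := by
      have : (fun Q : Fin s → Vec d => F ((0, q₀, v₀), Q)) = fun Q => Q - fun _ => q₀ := by
        funext Q i
        simp [F]
      rw [this]
      exact (hasFDerivAt_id _).sub_const _
    exact h1.unique h2
  have hinv : (fderiv ℝ F u ∘L .inr ℝ (ℝ × Vec d × Vec d) (Fin s → Vec d)).IsInvertible := by
    rw [hinr]
    exact ⟨.refl ℝ _, rfl⟩
  refine ⟨hF.implicitFunction one_ne_zero hinv, hF.contDiffAt_implicitFunction one_ne_zero hinv,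
    hF.implicitFunction_apply_self one_ne_zero hinv, ?_⟩
  filter_upwards [hF.eventually_apply_eq_iff_implicitFunction one_ne_zero hinv] with p hp
  rw [← hp, hFu, funext_iff]
  exact forall_congr' fun i => by simp only [F, Pi.zero_apply, sub_eq_zero]

/-! ### Expansions at zero -/

open Asymptotics Filter in
/-- `g` agrees with `∑ l < K, s ^ (l + p) • a l` up to `O(s ^ (K + p))` at `s = 0`. -/
def HasExpansion {E : Type*} [NormedAddCommGroup E] [NormedSpace ℝ E] (g : ℝ → E) (p : ℕ)
    (a : ℕ → E) (K : ℕ) : Prop :=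
  (fun s : ℝ => g s - ∑ l ∈ Finset.range K, s ^ (l + p) • a l) =O[𝓝 0] fun s : ℝ => s ^ (K + p)

section Expansion

open Asymptotics Filter

variable {E : Type*} [NormedAddCommGroup E] [NormedSpace ℝ E]

theorem isBigO_pow_pow_of_le {m n : ℕ} (h : n ≤ m) :
    (fun s : ℝ => s ^ m) =O[𝓝 0] fun s : ℝ => s ^ n := by
  obtain ⟨k, rfl⟩ := Nat.exists_eq_add_of_le h
  have : (fun s : ℝ => s ^ k) =O[𝓝 0] fun _ : ℝ => (1 : ℝ) :=
    (continuous_pow k).continuousAt.isBigO_one ℝ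
  simpa [pow_add] using (isBigO_refl (fun s : ℝ => s ^ n) (𝓝 0)).mul this

theorem isBigO_pow_smul_const (a : E) (n : ℕ) :
    (fun s : ℝ => s ^ n • a) =O[𝓝 0] fun s : ℝ => s ^ n := by
  simpa using (isBigO_refl (fun s : ℝ => s ^ n) (𝓝 0)).smul
    (isBigO_const_const a (one_ne_zero' ℝ) (𝓝 (0 : ℝ)))

/-- If the coefficients of order below `n` vanish, the function is `O(s ^ n)`. -/
theorem HasExpansion.isBigO {g : ℝ → E} {p : ℕ} {a : ℕ → E} {K n : ℕ} (h : HasExpansion g p a K)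
    (hn : n ≤ K + p) (ha : ∀ l, l + p < n → a l = 0) : g =O[𝓝 0] fun s : ℝ => s ^ n := by
  have h1 : (fun s : ℝ => ∑ l ∈ Finset.range K, s ^ (l + p) • a l) =O[𝓝 0] fun s : ℝ => s ^ n := by
    refine IsBigO.fun_sum fun l _ => ?_
    by_cases hl : l + p < n
    · simpa [ha l hl] using isBigO_zero _ _
    · exact (isBigO_pow_smul_const _ _).trans (isBigO_pow_pow_of_le (by omega))
  exact ((h.trans (isBigO_pow_pow_of_le hn)).add h1).congr_left fun s => by abel

theorem HasExpansion.sub {g g' : ℝ → E} {p : ℕ} {a a' : ℕ → E} {K : ℕ} (h : HasExpansion g p a K)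
    (h' : HasExpansion g' p a' K) :
    HasExpansion (fun s => g s - g' s) p (fun l => a l - a' l) K :=
  (IsBigO.sub h h').congr_left fun s => by
    simp only [smul_sub, Finset.sum_sub_distrib]
    abel

theorem HasExpansion.const_smul {g : ℝ → E} {p : ℕ} {a : ℕ → E} {K : ℕ} (h : HasExpansion g p a K)
    (r : ℝ) : HasExpansion (fun s => r • g s) p (fun l => r • a l) K :=
  (IsBigO.const_smul_left h r).congr_left fun s => by
    simp only [Pi.smul_apply, smul_sub, Finset.smul_sum, smul_comm r]

theorem HasExpansion.sum {ι : Type*} {t : Finset ι} {g : ι → ℝ → E} {p : ℕ} {a : ι → ℕ → E}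
    {K : ℕ} (h : ∀ i ∈ t, HasExpansion (g i) p (a i) K) :
    HasExpansion (fun s => ∑ i ∈ t, g i s) p (fun l => ∑ i ∈ t, a i l) K :=
  (IsBigO.fun_sum h).congr_left fun s => by
    simp only [Finset.smul_sum, Finset.sum_sub_distrib]
    rw [Finset.sum_comm]

theorem HasExpansion.pow_smul {g : ℝ → E} {p : ℕ} {a : ℕ → E} {K : ℕ} (h : HasExpansion g p a K)
    (r : ℕ) : HasExpansion (fun s => s ^ r • g s) (p + r) a K := by
  refine (((isBigO_refl (fun s : ℝ => s ^ r) (𝓝 0)).smul h).congr ?_ ?_)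
  · intro s
    simp only [smul_sub, Finset.smul_sum, smul_smul, ← pow_add]
    congr 1
    exact Finset.sum_congr rfl fun l _ => by congr 2; ring
  · intro s
    simp only [smul_eq_mul, ← pow_add]
    congr 1
    ring

theorem tendsto_mul_nhds_zero (c : ℝ) : Tendsto (fun s : ℝ => c * s) (𝓝 0) (𝓝 0) := by
  simpa using (continuous_const_mul c).tendsto (0 : ℝ)

theorem isBigO_mul_pow (c : ℝ) (n : ℕ) : (fun s : ℝ => (c * s) ^ n) =O[𝓝 0] fun s : ℝ => s ^ n := by
  simp only [mul_pow]
  exact (isBigO_refl (fun s : ℝ => s ^ n) (𝓝 0)).const_mul_left _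

theorem HasExpansion.comp_mul {g : ℝ → E} {p : ℕ} {a : ℕ → E} {K : ℕ} (h : HasExpansion g p a K)
    (c : ℝ) : HasExpansion (fun s => g (c * s)) p (fun l => c ^ (l + p) • a l) K := by
  refine ((h.comp_tendsto (tendsto_mul_nhds_zero c)).trans (isBigO_mul_pow c _)).congr_left ?_
  intro s
  simp only [Function.comp_apply, mul_pow, smul_smul]
  congr 1
  exact Finset.sum_congr rfl fun l _ => by congr 1; ring

/-- Taylor's theorem at zero. -/
theorem ContDiffAt.exists_hasExpansion {g : ℝ → E} {K : ℕ} (hg : ContDiffAt ℝ K g 0) :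
    ∃ a : ℕ → E, HasExpansion g 0 a K := by
  obtain ⟨u, hu, hgu⟩ := hg.contDiffOn le_rfl (by simp)
  obtain ⟨ε, hε, hεu⟩ := Metric.mem_nhds_iff.1 hu
  have h := taylor_isLittleO (convex_ball (0 : ℝ) ε) (Metric.mem_ball_self hε) (hgu.mono hεu)
  rw [nhdsWithin_eq_nhds.2 (Metric.ball_mem_nhds _ hε)] at h
  refine ⟨fun l => ((l.factorial : ℝ)⁻¹) • iteratedDerivWithin l g (Metric.ball 0 ε) 0, ?_⟩
  have h1 : HasExpansion g 0
      (fun l => ((l.factorial : ℝ)⁻¹) • iteratedDerivWithin l g (Metric.ball 0 ε) 0) K := by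
    -- The Taylor polynomial here has degree `K`, while `HasExpansion` stops at degree `K - 1`; the
    -- top term is absorbed into `O(s ^ K)`.
    have h2 := h.isBigO
    simp only [sub_zero] at h2
    refine (h2.add (isBigO_pow_smul_const
      (((K.factorial : ℝ)⁻¹) • iteratedDerivWithin K g (Metric.ball 0 ε) 0) K)).congr_left
      fun s => ?_
    rw [taylor_within_apply, Finset.sum_range_succ]
    simp only [sub_zero, smul_smul, mul_comm, add_zero]
    abel
  exact h1

/-- Mean value inequality on `|x| ≤ |t|`, where the derivative is at most `C |t| ^ K`. -/
theorem isBigO_pow_succ_of_hasDerivAt {R R' : ℝ → E} {K : ℕ} (h0 : R 0 = 0)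
    (hd : ∀ᶠ t in 𝓝 (0 : ℝ), HasDerivAt R (R' t) t)
    (hR : R' =O[𝓝 0] fun s : ℝ => s ^ K) : R =O[𝓝 0] fun s : ℝ => s ^ (K + 1) := by
  obtain ⟨C, hC⟩ := hR.bound
  obtain ⟨ε, hε, hb⟩ := Metric.eventually_nhds_iff_ball.1 (hd.and hC)
  refine IsBigO.of_bound C (Metric.eventually_nhds_iff_ball.2 ⟨ε, hε, fun t ht => ?_⟩)
  have hsub : ∀ x ∈ Metric.closedBall (0 : ℝ) |t|, x ∈ Metric.ball (0 : ℝ) ε := by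
    intro x hx
    simp only [Metric.mem_ball, Metric.mem_closedBall, dist_zero_right, Real.norm_eq_abs] at *
    exact hx.trans_lt ht
  -- The constant of an `O`-bound need not be nonnegative; the bound at a nonzero `t` forces it, and
  -- monotonicity in `|x|` needs it.
  have hC0 : t ≠ 0 → 0 ≤ C := fun h => by
    have h1 := (norm_nonneg _).trans (hb t ht).2
    have h2 : 0 < ‖t ^ K‖ := norm_pos_iff.2 (pow_ne_zero _ h)
    exact nonneg_of_mul_nonneg_left h1 h2
  by_cases h : t = 0
  · simp [h, h0]
  have := (convex_closedBall (0 : ℝ) |t|).norm_image_sub_le_of_norm_hasDerivWithin_le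
    (f := R) (f' := R') (C := C * |t| ^ K) (x := 0) (y := t)
    (fun x hx => (hb x (hsub x hx)).1.hasDerivWithinAt)
    (fun x hx => (hb x (hsub x hx)).2.trans (by
      rw [norm_pow, Real.norm_eq_abs]
      have : |x| ≤ |t| := by simpa using hx
      have := hC0 h
      gcongr))
    (by simp) (by simp)
  simpa [h0, pow_succ, mul_assoc] using this

/-- Expansions may be integrated term by term. -/
theorem HasExpansion.integrate {w g : ℝ → E} {p : ℕ} {a : ℕ → E} {K : ℕ}
    (hg : HasExpansion g p a K) (hw : ∀ᶠ t in 𝓝 (0 : ℝ), HasDerivAt w (g t) t) (h0 : w 0 = 0) :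
    HasExpansion w (p + 1) (fun l => ((l + p + 1 : ℝ))⁻¹ • a l) K := by
  refine isBigO_pow_succ_of_hasDerivAt (K := K + p) (by simp [h0]) ?_ hg
  filter_upwards [hw] with t ht
  refine ht.sub (HasDerivAt.fun_sum fun l _ => ?_)
  have h1 : HasDerivAt (fun s : ℝ => s ^ (l + (p + 1)) * (l + p + 1 : ℝ)⁻¹) (t ^ (l + p)) t := by
    have := (hasDerivAt_pow (l + p + 1) t).mul_const (l + p + 1 : ℝ)⁻¹
    refine this.congr_deriv ?_
    have : (l : ℝ) + p + 1 ≠ 0 := by positivity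
    push_cast
    field_simp
  simpa [smul_smul] using h1.smul_const (a l)

/-- Quadratic remainder bound for a `C²` map near a point. -/
theorem ContDiffAt.exists_quadratic_bound {X Y : Type*} [NormedAddCommGroup X] [NormedSpace ℝ X]
    [NormedAddCommGroup Y] [NormedSpace ℝ Y] {F : X → Y} {x₀ : X} (hF : ContDiffAt ℝ 2 F x₀) :
    ∃ K : ℝ, ∀ᶠ p : X × X in 𝓝 (x₀, x₀),
      ‖F p.2 - F p.1 - fderiv ℝ F p.1 (p.2 - p.1)‖ ≤ K * ‖p.2 - p.1‖ ^ 2 := by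
  have h1 : ContDiffAt ℝ 1 (fderiv ℝ F) x₀ := hF.fderiv_right (by norm_num)
  -- The derivative is locally Lipschitz; the mean value inequality for `F - F'(p.1)` on the segment
  -- then gives the square.
  obtain ⟨K, t, ht, hK⟩ := h1.exists_lipschitzOnWith
  have h2 : ∀ᶠ x in 𝓝 x₀, DifferentiableAt ℝ F x := by
    filter_upwards [hF.eventually (by simp)] with x hx using hx.differentiableAt (by simp)
  obtain ⟨ε, hε, hb⟩ := Metric.eventually_nhds_iff_ball.1 (h2.and ht)
  refine ⟨K, ?_⟩
  filter_upwards [prod_mem_nhds (Metric.ball_mem_nhds x₀ hε) (Metric.ball_mem_nhds x₀ hε)]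
    with p hp
  have hseg : segment ℝ p.1 p.2 ⊆ Metric.ball x₀ ε :=
    (convex_ball x₀ ε).segment_subset hp.1 hp.2
  have := (convex_segment p.1 p.2).norm_image_sub_le_of_norm_hasFDerivWithin_le'
    (f := F) (f' := fderiv ℝ F) (φ := fderiv ℝ F p.1) (C := K * ‖p.2 - p.1‖)
    (fun x hx => (hb x (hseg hx)).1.hasFDerivAt.hasFDerivWithinAt)
    (fun x hx => by
      refine (hK.norm_sub_le (hb x (hseg hx)).2 (hb _ hp.1).2).trans ?_
      gcongr
      obtain ⟨a, b, ha, hb, hab, rfl⟩ := hx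
      have : a • p.1 + b • p.2 - p.1 = b • (p.2 - p.1) := by
        obtain rfl : a = 1 - b := by linarith
        module
      rw [this, norm_smul, Real.norm_of_nonneg hb]
      exact mul_le_of_le_one_left (norm_nonneg _) (by linarith))
    (left_mem_segment _ _ _) (right_mem_segment _ _ _)
  rw [pow_two, ← mul_assoc]
  exact this

end Expansion

/-! ### Order conditions and stage errors -/

/-- The simplifying conditions `B(2k)`, `CN(k)`, `DN(k)` for Runge-Kutta-Nyström methods, together
with `b̄ᵢ = bᵢ (1 - cᵢ)`. -/
structure RKNMethod.SimplifyingConditions {s : ℕ} (T : RKNMethod s) (k : ℕ) : Prop where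
  quadrature : ∀ r < 2 * k, ∑ i, T.b i * T.c i ^ r = 1 / (r + 1)
  stage : ∀ r, r + 1 < k → ∀ i,
    ∑ j, T.A i j * T.c j ^ r = T.c i ^ (r + 2) / ((r + 1) * (r + 2))
  adjoint : ∀ m, m + 1 < k → ∀ j, ∑ i, T.b i * T.c i ^ m * T.A i j =
    T.b j * (T.c j ^ (m + 2) / ((m + 1) * (m + 2)) - T.c j / (m + 1) + 1 / (m + 2))
  bbar_eq : ∀ i, T.bbar i = T.b i * (1 - T.c i)

section StageError

open Asymptotics Filter

variable {X Y : Type*} [NormedAddCommGroup X] [NormedSpace ℝ X] [NormedAddCommGroup Y]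
  [NormedSpace ℝ Y]

theorem IsBigO.clm_apply_real {A : ℝ → X →L[ℝ] Y} {x : ℝ → X} {m n : ℕ}
    (hA : A =O[𝓝 0] fun s : ℝ => s ^ m) (hx : x =O[𝓝 0] fun s : ℝ => s ^ n) :
    (fun s => A s (x s)) =O[𝓝 0] fun s : ℝ => s ^ (m + n) := by
  have h1 : (fun s => A s (x s)) =O[𝓝 0] fun s => ‖A s‖ * ‖x s‖ :=
    IsBigO.of_bound 1 (Eventually.of_forall fun s => by
      simpa using (A s).le_opNorm (x s))
  simpa only [pow_add] using h1.trans (hA.norm_left.mul hx.norm_left)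

theorem IsBigO.pow_smul_real {x : ℝ → X} {m n : ℕ} (hx : x =O[𝓝 0] fun s : ℝ => s ^ n) :
    (fun s => s ^ m • x s) =O[𝓝 0] fun s : ℝ => s ^ (m + n) := by
  simpa only [pow_add, smul_eq_mul] using (isBigO_refl (fun s : ℝ => s ^ m) (𝓝 0)).smul hx

variable {s : ℕ} {b c : Fin s → ℝ} {e : Fin s → ℝ → X}

/-- Transfers bounds from weighted means of the stage errors `e` to those of the induced errors `Δ`
in the vector field. Writing `J(cᵢ h) = ∑ h^l cᵢ^l a_l + O(h^k)`, the term of index `l` is `h^l a_l`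
applied to the mean of weight `bᵢ cᵢ^(r+l)`: the power lost in the weight is regained from `h^l`.
The Taylor remainder contributes `O(h^(2k+1))` and the quadratic remainder `O(h^(2k+2))`. -/
theorem isBigO_weighted_sum {J : ℝ → X →L[ℝ] Y} {a : ℕ → X →L[ℝ] Y} {Δ : Fin s → ℝ → Y} {k n : ℕ}
    (hJ : HasExpansion J 0 a k) (he : ∀ i, e i =O[𝓝 0] fun h : ℝ => h ^ (k + 1))
    (hΔ : ∀ i, (fun h => Δ i h - J (c i * h) (e i h)) =O[𝓝 0] fun h : ℝ => ‖e i h‖ ^ 2)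
    (hn : n ≤ 2 * k)
    (hG : ∀ m, (fun h => ∑ i, (b i * c i ^ m) • e i h) =O[𝓝 0] fun h : ℝ => h ^ min n (2 * k - m))
    (r : ℕ) :
    (fun h => ∑ i, (b i * c i ^ r) • Δ i h) =O[𝓝 0] fun h : ℝ => h ^ min n (2 * k - r) := by
  have h1 : (fun h => ∑ i, (b i * c i ^ r) • (Δ i h - J (c i * h) (e i h)))
      =O[𝓝 0] fun h : ℝ => h ^ min n (2 * k - r) := by
    refine IsBigO.fun_sum fun i _ => IsBigO.const_smul_left ?_ _
    have := (he i).norm_left.pow 2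
    simp only [← pow_mul] at this
    exact ((hΔ i).trans this).trans (isBigO_pow_pow_of_le (by omega))
  have h2 : (fun h => ∑ i, (b i * c i ^ r) •
      (J (c i * h) - ∑ l ∈ Finset.range k, h ^ (l + 0) • c i ^ (l + 0) • a l) (e i h))
      =O[𝓝 0] fun h : ℝ => h ^ min n (2 * k - r) := by
    refine IsBigO.fun_sum fun i _ => IsBigO.const_smul_left ?_ _
    exact (IsBigO.clm_apply_real (hJ.comp_mul (c i)) (he i)).trans
      (isBigO_pow_pow_of_le (by omega))
  have h3 : (fun h : ℝ => ∑ l ∈ Finset.range k, h ^ l • a l (∑ i, (b i * c i ^ (r + l)) • e i h))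
      =O[𝓝 0] fun h : ℝ => h ^ min n (2 * k - r) := by
    refine IsBigO.fun_sum fun l _ => ?_
    refine (IsBigO.pow_smul_real (((a l).isBigO_comp _ _).trans (hG (r + l)))).trans
      (isBigO_pow_pow_of_le (by omega))
  refine ((h1.add h2).add h3).congr_left fun h => ?_
  have h4 : ∑ l ∈ Finset.range k, h ^ l • a l (∑ i, (b i * c i ^ (r + l)) • e i h) =
      ∑ i, (b i * c i ^ r) •
        (∑ l ∈ Finset.range k, h ^ (l + 0) • c i ^ (l + 0) • a l) (e i h) := by
    simp only [map_sum, Finset.smul_sum, sum_apply, map_smul,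
      smul_apply, add_zero]
    rw [Finset.sum_comm]
    refine Finset.sum_congr rfl fun i _ => Finset.sum_congr rfl fun l _ => ?_
    simp only [smul_smul]
    congr 1
    ring
  rw [h4, ← Finset.sum_add_distrib, ← Finset.sum_add_distrib]
  refine Finset.sum_congr rfl fun i _ => ?_
  rw [← smul_add, ← smul_add]
  congr 1
  simp

variable {T : RKNMethod s} {k : ℕ} {J : ℝ → X →L[ℝ] X} {a : ℕ → X →L[ℝ] X} {Δ δ : Fin s → ℝ → X}

/-- Bootstrapping: starting from boundedness, the factor `h ^ 2` in front of `Δ = O(e)` improves the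
bound until the defect dominates. Each round gains two powers, of which one is used. -/
theorem isBigO_stage_error (hk : 1 ≤ k) (hJ : HasExpansion J 0 a k)
    (he0 : ∀ i, e i =O[𝓝 0] fun _ : ℝ => (1 : ℝ))
    (he : ∀ i, ∀ᶠ h in 𝓝 (0 : ℝ), e i h = h ^ 2 • ∑ j, T.A i j • Δ j h - δ i h)
    (hΔ : ∀ i, (fun h => Δ i h - J (T.c i * h) (e i h)) =O[𝓝 0] fun h : ℝ => ‖e i h‖ ^ 2)
    (hδ : ∀ i, δ i =O[𝓝 0] fun h : ℝ => h ^ (k + 1)) (i : Fin s) :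
    e i =O[𝓝 0] fun h : ℝ => h ^ (k + 1) := by
  have key : ∀ n, ∀ i, e i =O[𝓝 0] fun h : ℝ => h ^ min n (k + 1) := by
    intro n
    induction n with
    | zero => simpa using he0
    | succ n ih =>
      have hΔ' : ∀ i, Δ i =O[𝓝 0] fun h : ℝ => h ^ min n (k + 1) := by
        intro i
        -- One factor is bounded by `he0`, the other by the induction hypothesis.
        have h1 : (fun h : ℝ => ‖e i h‖ ^ 2) =O[𝓝 0] fun h : ℝ => h ^ min n (k + 1) := by
          have := (he0 i).norm_left.mul (ih i).norm_left
          simpa [pow_two] using this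
        have h2 : (fun h => J (T.c i * h) (e i h)) =O[𝓝 0] fun h : ℝ => h ^ min n (k + 1) := by
          have h3 : J =O[𝓝 0] fun h : ℝ => h ^ 0 := hJ.isBigO (by omega) (by omega)
          have h4 := (h3.comp_tendsto (tendsto_mul_nhds_zero (T.c i))).trans
            (isBigO_mul_pow (T.c i) 0)
          simpa using IsBigO.clm_apply_real h4 (ih i)
        exact (((hΔ i).trans h1).add h2).congr_left fun h => by abel
      intro i
      have h1 : (fun h : ℝ => h ^ 2 • ∑ j, T.A i j • Δ j h - δ i h)
          =O[𝓝 0] fun h : ℝ => h ^ min (n + 1) (k + 1) := by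
        refine IsBigO.sub ?_ ((hδ i).trans (isBigO_pow_pow_of_le (by omega)))
        exact (IsBigO.pow_smul_real (IsBigO.fun_sum fun j _ =>
          (hΔ' j).const_smul_left (T.A i j))).trans (isBigO_pow_pow_of_le (by omega))
      exact h1.congr' ((he i).mono fun h hh => hh.symm) EventuallyEq.rfl
  simpa using key (k + 1) i

/-- The superconvergence step. Summing the error equation against `bᵢ cᵢ^m`, the adjoint condition
replaces the coefficients `āᵢⱼ` by weights `bⱼ cⱼ^(m+2)`, `bⱼ cⱼ`, `bⱼ` on `Δⱼ`, so the family of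
weighted means closes up and can be bootstrapped. -/
theorem isBigO_weighted_stage_error (hT : T.SimplifyingConditions k) (hJ : HasExpansion J 0 a k)
    (he : ∀ i, e i =O[𝓝 0] fun h : ℝ => h ^ (k + 1))
    (hst : ∀ i, ∀ᶠ h in 𝓝 (0 : ℝ), e i h = h ^ 2 • ∑ j, T.A i j • Δ j h - δ i h)
    (hΔ : ∀ i, (fun h => Δ i h - J (T.c i * h) (e i h)) =O[𝓝 0] fun h : ℝ => ‖e i h‖ ^ 2)
    (hδ : ∀ m, m + 1 < k →
      (fun h => ∑ i, (T.b i * T.c i ^ m) • δ i h) =O[𝓝 0] fun h : ℝ => h ^ (2 * k - m)) (m : ℕ) :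
    (fun h => ∑ i, (T.b i * T.c i ^ m) • e i h) =O[𝓝 0] fun h : ℝ => h ^ (2 * k - m) := by
  have key : ∀ n ≤ 2 * k, ∀ m, (fun h => ∑ i, (T.b i * T.c i ^ m) • e i h)
      =O[𝓝 0] fun h : ℝ => h ^ min n (2 * k - m) := by
    intro n hn
    induction n with
    | zero =>
      intro m
      exact IsBigO.fun_sum fun i _ => ((he i).trans
        (isBigO_pow_pow_of_le (by omega))).const_smul_left (T.b i * T.c i ^ m)
    | succ n ih =>
      have hD := isBigO_weighted_sum hJ he hΔ (by omega) (ih (by omega))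
      intro m
      -- For `m ≥ k - 1` one has `2k - m ≤ k + 1`, so the individual stage errors are already small
      -- enough. Otherwise the factor `h ^ 2` makes up for the weight `m + 2`.
      by_cases hm : m + 1 < k
      · have h1 : (fun h : ℝ => h ^ 2 •
            (((((m : ℝ) + 1) * (m + 2))⁻¹) • (∑ j, (T.b j * T.c j ^ (m + 2)) • Δ j h)
              - (((m : ℝ) + 1)⁻¹) • (∑ j, (T.b j * T.c j ^ 1) • Δ j h)
              + (((m : ℝ) + 2)⁻¹) • (∑ j, (T.b j * T.c j ^ 0) • Δ j h)))
            =O[𝓝 0] fun h : ℝ => h ^ min (n + 1) (2 * k - m) := by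
          have h2 := (((hD (m + 2)).const_smul_left (((m : ℝ) + 1) * (m + 2))⁻¹).trans
            (isBigO_pow_pow_of_le (n := min n (2 * k - (m + 2))) le_rfl))
          have h3 := (((hD 1).const_smul_left ((m : ℝ) + 1)⁻¹).trans
            (isBigO_pow_pow_of_le (n := min n (2 * k - (m + 2))) (by omega)))
          have h4 := (((hD 0).const_smul_left ((m : ℝ) + 2)⁻¹).trans
            (isBigO_pow_pow_of_le (n := min n (2 * k - (m + 2))) (by omega)))
          exact (IsBigO.pow_smul_real ((h2.sub h3).add h4)).trans
            (isBigO_pow_pow_of_le (by omega))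
        refine (h1.sub ((hδ m hm).trans (isBigO_pow_pow_of_le (by omega)))).congr'
          ?_ EventuallyEq.rfl
        filter_upwards [eventually_all.2 hst] with h hh
        simp only [hh, smul_sub, Finset.sum_sub_distrib]
        congr 1
        simp only [Finset.smul_sum, smul_smul]
        rw [← Finset.sum_sub_distrib, ← Finset.sum_add_distrib, Finset.sum_comm]
        rw [Finset.smul_sum]
        refine Finset.sum_congr rfl fun j _ => ?_
        rw [← sub_smul, ← add_smul, ← Finset.sum_smul, smul_smul]
        congr 1
        have h5 : ∑ i, T.b i * T.c i ^ m * h ^ 2 * T.A i j =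
            h ^ 2 * ∑ i, T.b i * T.c i ^ m * T.A i j := by
          rw [Finset.mul_sum]
          exact Finset.sum_congr rfl fun i _ => by ring
        simp only [← mul_assoc]
        rw [h5, hT.adjoint m hm j]
        ring
      · exact IsBigO.fun_sum fun i _ => ((he i).trans
          (isBigO_pow_pow_of_le (by omega))).const_smul_left (T.b i * T.c i ^ m)
  simpa using key (2 * k) le_rfl m

/-! ### Defect of the exact solution -/

/-- The defect of the exact solution `q'' = g` in the stage equations. -/
def RKNMethod.defect (T : RKNMethod s) (q g : ℝ → X) (v₀ : X) (i : Fin s) (h : ℝ) : X :=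
  q (T.c i * h) - q 0 - (T.c i * h) • v₀ - h ^ 2 • ∑ j, T.A i j • g (T.c j * h)

theorem HasExpansion.integrate_twice {q v g : ℝ → X} {α : ℕ → X} {K : ℕ}
    (hg : HasExpansion g 0 α K) (hq : ∀ᶠ t in 𝓝 (0 : ℝ), HasDerivAt q (v t) t)
    (hv : ∀ᶠ t in 𝓝 (0 : ℝ), HasDerivAt v (g t) t) :
    HasExpansion (fun t => q t - q 0 - t • v 0) 2
      (fun l => (((l + 1) * (l + 2) : ℝ))⁻¹ • α l) K := by
  have h1 : HasExpansion (fun t => v t - v 0) (0 + 1) _ K :=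
    hg.integrate (hv.mono fun t ht => ht.sub_const _) (by simp)
  have h2 := h1.integrate (w := fun t => q t - q 0 - t • v 0) (hq.mono fun t ht =>
    (ht.sub_const _).sub (by simpa using (hasDerivAt_id t).smul_const (v 0))) (by simp)
  convert h2 using 1
  funext l
  rw [smul_smul, ← mul_inv]
  congr 2
  push_cast
  ring

theorem RKNMethod.hasExpansion_defect (T : RKNMethod s) {q g : ℝ → X} {v₀ : X} {α : ℕ → X} {K : ℕ}
    (hg : HasExpansion g 0 α K)
    (hq : HasExpansion (fun t => q t - q 0 - t • v₀) 2
      (fun l => (((l + 1) * (l + 2) : ℝ))⁻¹ • α l) K) (i : Fin s) :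
    HasExpansion (T.defect q g v₀ i) 2 (fun l =>
      (T.c i ^ (l + 2) / ((l + 1) * (l + 2)) - ∑ j, T.A i j * T.c j ^ l) • α l) K := by
  have h1 := (hq.comp_mul (T.c i)).sub ((HasExpansion.sum (t := Finset.univ) fun j _ =>
    (hg.comp_mul (T.c j)).const_smul (T.A i j)).pow_smul 2)
  have h2 : (fun l : ℕ => (T.c i ^ (l + 2) / ((l + 1) * (l + 2)) - ∑ j, T.A i j * T.c j ^ l) • α l)
      = fun l : ℕ => T.c i ^ (l + 2) • ((l + 1) * (l + 2) : ℝ)⁻¹ • α l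
        - ∑ j, T.A i j • T.c j ^ (l + 0) • α l := by
    funext l
    simp only [smul_smul, ← Finset.sum_smul, ← sub_smul, add_zero, div_eq_mul_inv]
  rw [h2]
  exact h1

/-- The coefficient of `h^(l+2)` is the residual of the stage condition of index `l`; the conditions
with `l ≤ k - 2` remove the powers up to `h^k`. -/
theorem isBigO_defect (hT : T.SimplifyingConditions k) {q g : ℝ → X} {v₀ : X} {α : ℕ → X}
    (hg : HasExpansion g 0 α (2 * k))
    (hq : HasExpansion (fun t => q t - q 0 - t • v₀) 2
      (fun l => (((l + 1) * (l + 2) : ℝ))⁻¹ • α l) (2 * k)) (i : Fin s) :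
    T.defect q g v₀ i =O[𝓝 0] fun h : ℝ => h ^ (k + 1) :=
  (T.hasExpansion_defect hg hq i).isBigO (by omega) fun l hl => by
    rw [hT.stage l (by omega) i, sub_self, zero_smul]

/-- After weighting, the adjoint condition reduces each residual to moments of the quadrature
formula, the highest exponent being `m + l + 2`. They are exact as long as this is below `2k`, which
goes far beyond the stage conditions. -/
theorem isBigO_weighted_defect (hT : T.SimplifyingConditions k) {q g : ℝ → X} {v₀ : X}
    {α : ℕ → X} (hg : HasExpansion g 0 α (2 * k))
    (hq : HasExpansion (fun t => q t - q 0 - t • v₀) 2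
      (fun l => (((l + 1) * (l + 2) : ℝ))⁻¹ • α l) (2 * k)) (m : ℕ) (hm : m + 1 < k) :
    (fun h => ∑ i, (T.b i * T.c i ^ m) • T.defect q g v₀ i h)
      =O[𝓝 0] fun h : ℝ => h ^ (2 * k - m) := by
  refine (HasExpansion.sum (t := Finset.univ) fun i _ =>
    (T.hasExpansion_defect hg hq i).const_smul (T.b i * T.c i ^ m)).isBigO (by omega) fun l hl => ?_
  simp only [smul_smul, ← Finset.sum_smul]
  suffices h : ∑ i, T.b i * T.c i ^ m * (T.c i ^ (l + 2) / ((l + 1) * (l + 2))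
      - ∑ j, T.A i j * T.c j ^ l) = 0 by rw [h, zero_smul]
  have h1 : ∑ i, T.b i * T.c i ^ m * ∑ j, T.A i j * T.c j ^ l =
      ((m + 1 : ℝ) * (m + 2))⁻¹ * ∑ j, T.b j * T.c j ^ (m + l + 2)
        - (m + 1 : ℝ)⁻¹ * ∑ j, T.b j * T.c j ^ (l + 1) + (m + 2 : ℝ)⁻¹ * ∑ j, T.b j * T.c j ^ l := by
    simp only [Finset.mul_sum]
    rw [← Finset.sum_sub_distrib, ← Finset.sum_add_distrib, Finset.sum_comm]
    refine Finset.sum_congr rfl fun j _ => ?_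
    have h2 : ∑ i, T.b i * T.c i ^ m * (T.A i j * T.c j ^ l) =
        (∑ i, T.b i * T.c i ^ m * T.A i j) * T.c j ^ l := by
      rw [Finset.sum_mul]
      exact Finset.sum_congr rfl fun i _ => by ring
    rw [h2, hT.adjoint m hm j]
    ring
  have h2 : ∑ i, T.b i * T.c i ^ m * (T.c i ^ (l + 2) / ((l + 1) * (l + 2))) =
      ((l + 1 : ℝ) * (l + 2))⁻¹ * ∑ i, T.b i * T.c i ^ (m + l + 2) := by
    rw [Finset.mul_sum]
    exact Finset.sum_congr rfl fun i _ => by ring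
  simp only [mul_sub, Finset.sum_sub_distrib]
  rw [h1, h2, hT.quadrature _ (by omega), hT.quadrature _ (by omega), hT.quadrature _ (by omega)]
  push_cast
  have : (l : ℝ) + 1 ≠ 0 := by positivity
  have : (l : ℝ) + 2 ≠ 0 := by positivity
  have : (m : ℝ) + 1 ≠ 0 := by positivity
  have : (m : ℝ) + 2 ≠ 0 := by positivity
  have : (m : ℝ) + l + 2 + 1 ≠ 0 := by positivity
  have : (l : ℝ) + 1 + 1 ≠ 0 := by positivity
  field_simp
  ring

/-! ### Local error of the update formulas -/

/-- Quadrature error plus propagated stage error of `w' = g` is `O(h ^ (2k + 1))`. -/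
theorem isBigO_update (hT : T.SimplifyingConditions k) {w g : ℝ → Y} {α : ℕ → Y}
    (hg : HasExpansion g 0 α (2 * k)) (hw : ∀ᶠ t in 𝓝 (0 : ℝ), HasDerivAt w (g t) t)
    {Δ : Fin s → ℝ → Y}
    (hD : (fun h => ∑ i, (T.b i * T.c i ^ 0) • Δ i h) =O[𝓝 0] fun h : ℝ => h ^ (2 * k)) :
    (fun h => w h - (w 0 + h • ∑ i, T.b i • (g (T.c i * h) + Δ i h)))
      =O[𝓝 0] fun h : ℝ => h ^ (2 * k + 1) := by
  have h1 := hg.integrate (w := fun t => w t - w 0) (hw.mono fun t ht => ht.sub_const _) (by simp)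
  have h2 := (HasExpansion.sum (t := Finset.univ) fun j _ =>
    (hg.comp_mul (T.c j)).const_smul (T.b j)).pow_smul 1
  have h3 : (fun h => w h - w 0 - h ^ 1 • ∑ i, T.b i • g (T.c i * h))
      =O[𝓝 0] fun h : ℝ => h ^ (2 * k + 1) := by
    refine (h1.sub h2).isBigO le_rfl fun l hl => ?_
    simp only [smul_smul, ← Finset.sum_smul, ← sub_smul, add_zero]
    rw [hT.quadrature l (by omega)]
    simp
  have h4 := IsBigO.pow_smul_real (m := 1) hD
  refine (h3.sub (h4.trans (isBigO_pow_pow_of_le (by omega)))).congr_left fun h => ?_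
  simp only [smul_add, Finset.sum_add_distrib, pow_one, pow_zero, mul_one]
  abel

/-- Since `b̄ᵢ = bᵢ(1 - cᵢ)`, the quadrature is that of `∫ (1 - t) t^l dt = 1 / ((l+1)(l+2))`, and
the stage errors enter through the means of weights `bᵢ` and `bᵢ cᵢ`; the weaker bound `O(h^(2k-1))`
for the latter suffices because of the factor `h ^ 2`. -/
theorem isBigO_update_pos (hk : 1 ≤ k) (hT : T.SimplifyingConditions k) {q g : ℝ → X} {v₀ : X}
    {α : ℕ → X} (hg : HasExpansion g 0 α (2 * k))
    (hq : HasExpansion (fun t => q t - q 0 - t • v₀) 2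
      (fun l => (((l + 1) * (l + 2) : ℝ))⁻¹ • α l) (2 * k))
    (hD : ∀ r, (fun h => ∑ i, (T.b i * T.c i ^ r) • Δ i h)
      =O[𝓝 0] fun h : ℝ => h ^ (2 * k - r)) :
    (fun h => q h - (q 0 + h • v₀ + h ^ 2 • ∑ i, T.bbar i • (g (T.c i * h) + Δ i h)))
      =O[𝓝 0] fun h : ℝ => h ^ (2 * k + 1) := by
  have h2 := (HasExpansion.sum (t := Finset.univ) fun j _ =>
    (hg.comp_mul (T.c j)).const_smul (T.bbar j)).pow_smul 2
  have h3 : (fun h => q h - q 0 - h • v₀ - h ^ 2 • ∑ i, T.bbar i • g (T.c i * h))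
      =O[𝓝 0] fun h : ℝ => h ^ (2 * k + 1) := by
    refine (hq.sub h2).isBigO (by omega) fun l hl => ?_
    simp only [smul_smul, ← Finset.sum_smul, ← sub_smul, add_zero]
    suffices h : ((l + 1 : ℝ) * (l + 2))⁻¹ - ∑ i, T.bbar i * T.c i ^ l = 0 by rw [h, zero_smul]
    have h4 : ∑ i, T.bbar i * T.c i ^ l =
        ∑ i, T.b i * T.c i ^ l - ∑ i, T.b i * T.c i ^ (l + 1) := by
      rw [← Finset.sum_sub_distrib]
      exact Finset.sum_congr rfl fun i _ => by rw [hT.bbar_eq i]; ring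
    rw [h4, hT.quadrature _ (by omega), hT.quadrature _ (by omega)]
    push_cast
    have : (l : ℝ) + 1 ≠ 0 := by positivity
    have : (l : ℝ) + 2 ≠ 0 := by positivity
    have : (l : ℝ) + 1 + 1 ≠ 0 := by positivity
    field_simp
    ring
  have h4 := (IsBigO.pow_smul_real (m := 2) (hD 0)).trans
    (isBigO_pow_pow_of_le (n := 2 * k + 1) (by omega))
  have h5 := (IsBigO.pow_smul_real (m := 2) (hD 1)).trans
    (isBigO_pow_pow_of_le (n := 2 * k + 1) (by omega))
  refine (h3.sub (h4.sub h5)).congr_left fun h => ?_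
  rw [← smul_sub, ← Finset.sum_sub_distrib]
  simp only [smul_add, Finset.sum_add_distrib]
  have h6 : ∑ i, ((T.b i * T.c i ^ 0) • Δ i h - (T.b i * T.c i ^ 1) • Δ i h) =
      ∑ i, T.bbar i • Δ i h :=
    Finset.sum_congr rfl fun i _ => by rw [← sub_smul, hT.bbar_eq i]; congr 1; ring
  rw [h6]
  abel

end StageError

/-! ### Order of convergence -/

section Order

open Asymptotics Filter

/-- Solutions of `q' = v`, `v' = f(t, q)` inherit the smoothness of `f`. -/
theorem contDiffAt_solution {d N : ℕ} {f : ℝ → Vec d → Vec d} {t₀ : ℝ} {q v : ℝ → Vec d}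
    (hf : ContDiffAt ℝ N (fun x : ℝ × Vec d => f x.1 x.2) (t₀, q t₀))
    (hsol : ∀ᶠ t in 𝓝 t₀, HasDerivAt q (v t) t ∧ HasDerivAt v (f t (q t)) t) :
    ContDiffAt ℝ N q t₀ := by
  -- Each of `q`, `v` has a derivative expressed through the other or through `f` along `q`, so both
  -- gain regularity together.
  have key : ∀ n ≤ N, ContDiffAt ℝ n q t₀ ∧ ContDiffAt ℝ n v t₀ := by
    intro n hn
    induction n with
    | zero =>
      rw [Nat.cast_zero, contDiffAt_zero, contDiffAt_zero]
      exact ⟨⟨_, hsol, fun t ht => ht.1.continuousAt.continuousWithinAt⟩,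
        ⟨_, hsol, fun t ht => ht.2.continuousAt.continuousWithinAt⟩⟩
    | succ n ih =>
      obtain ⟨hq, hv⟩ := ih (by omega)
      have hfq : ContDiffAt ℝ n (fun t => f t (q t)) t₀ :=
        ContDiffAt.comp (g := fun x : ℝ × Vec d => f x.1 x.2) (f := fun t => (t, q t)) t₀
          (hf.of_le (by exact_mod_cast (by omega : n ≤ N))) (contDiffAt_id.prodMk hq)
      have step : ∀ {y y' : ℝ → Vec d}, (∀ᶠ t in 𝓝 t₀, HasDerivAt y (y' t) t) →
          ContDiffAt ℝ n y' t₀ → ContDiffAt ℝ (n + 1 : ℕ) y t₀ := by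
        intro y y' hy hy'
        push_cast
        rw [contDiffAt_succ_iff_hasFDerivAt]
        exact ⟨fun t => ContinuousLinearMap.toSpanSingleton ℝ (y' t),
          ⟨_, hy, fun t ht => ht.hasFDerivAt⟩,
          (ContinuousLinearMap.toSpanSingletonCLE
            (𝕜 := ℝ) (E := Vec d)).contDiff.contDiffAt.comp t₀ hy'⟩
      exact ⟨step (hsol.mono fun t ht => ht.1) hv, step (hsol.mono fun t ht => ht.2) hfq⟩
  exact (key N le_rfl).1

variable {s d : ℕ}

/-- The Jacobian in the second variable along a curve. -/
noncomputable def jacobianAlong {Y : Type*} [NormedAddCommGroup Y] [NormedSpace ℝ Y] (G : ℝ × Vec d → Y)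
    (t₀ : ℝ) (q : ℝ → Vec d) (t : ℝ) : Vec d →L[ℝ] Y :=
  fderiv ℝ G (t₀ + t, q (t₀ + t)) ∘L .inr ℝ ℝ (Vec d)

theorem contDiffAt_comp_curve {Z : Type*} [NormedAddCommGroup Z] [NormedSpace ℝ Z] {n : ℕ}
    {G : ℝ × Vec d → Z} {t₀ : ℝ} {q : ℝ → Vec d} (hG : ContDiffAt ℝ n G (t₀, q t₀))
    (hq : ContDiffAt ℝ n q t₀) : ContDiffAt ℝ n (fun t => G (t₀ + t, q (t₀ + t))) 0 := by
  have hq' : ContDiffAt ℝ n (fun t => q (t₀ + t)) 0 :=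
    ContDiffAt.comp (g := q) (f := fun t => t₀ + t) 0 (by simpa using hq) (by fun_prop)
  have hp : ContDiffAt ℝ n (fun t => (t₀ + t, q (t₀ + t))) 0 :=
    ContDiffAt.prodMk (by fun_prop) hq'
  exact ContDiffAt.comp (g := G) (f := fun t => (t₀ + t, q (t₀ + t))) 0 (by simpa using hG) hp

theorem contDiffAt_jacobianAlong {Y : Type*} [NormedAddCommGroup Y] [NormedSpace ℝ Y] {n : ℕ}
    {G : ℝ × Vec d → Y} {t₀ : ℝ} {q : ℝ → Vec d} (hG : ContDiffAt ℝ (n + 1 : ℕ) G (t₀, q t₀))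
    (hq : ContDiffAt ℝ n q t₀) : ContDiffAt ℝ n (jacobianAlong G t₀ q) 0 :=
  (contDiffAt_comp_curve (hG.fderiv_right (by norm_cast)) hq).clm_comp contDiffAt_const

theorem isBigO_linearization {Y : Type*} [NormedAddCommGroup Y] [NormedSpace ℝ Y]
    {G : ℝ × Vec d → Y} {t₀ c : ℝ} {q Q : ℝ → Vec d} (hG : ContDiffAt ℝ 2 G (t₀, q t₀))
    (hq : ContinuousAt q t₀) (hQ : Tendsto Q (𝓝 0) (𝓝 (q t₀))) :
    (fun h => (G (t₀ + c * h, Q h) - G (t₀ + c * h, q (t₀ + c * h)))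
        - jacobianAlong G t₀ q (c * h) (Q h - q (t₀ + c * h)))
      =O[𝓝 0] fun h : ℝ => ‖Q h - q (t₀ + c * h)‖ ^ 2 := by
  obtain ⟨K, hK⟩ := hG.exists_quadratic_bound
  have ht : Tendsto (fun h : ℝ => t₀ + c * h) (𝓝 0) (𝓝 t₀) := by
    simpa using (tendsto_mul_nhds_zero c).const_add t₀
  have h1 := (ht.prodMk_nhds (hq.tendsto.comp ht)).prodMk_nhds (ht.prodMk_nhds hQ)
  refine IsBigO.of_bound K ((h1.eventually hK).mono fun h hh => ?_)
  have h2 : ((t₀ + c * h, Q h) : ℝ × Vec d) - (t₀ + c * h, q (t₀ + c * h))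
      = (0, Q h - q (t₀ + c * h)) := by simp
  simp only [Function.comp_apply, h2] at hh
  simpa [jacobianAlong] using hh

variable {T : RKNMethod s} {k : ℕ} {f : ℝ → Vec d → Vec d} {t₀ : ℝ} {q v : ℝ → Vec d}
  {φ : ℝ → Fin s → Vec d}

theorem eventually_nhds_zero_add {P : ℝ → Prop} (h : ∀ᶠ t in 𝓝 t₀, P t) :
    ∀ᶠ t in 𝓝 (0 : ℝ), P (t₀ + t) := by
  have : Tendsto (fun h : ℝ => t₀ + h) (𝓝 0) (𝓝 t₀) := by
    simpa using (tendsto_id (α := ℝ) (x := 𝓝 0)).const_add t₀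
  exact this.eventually h

/-- Local errors of the position and of any quantity `w` with `w' = G(t, q)`. -/
theorem RKNMethod.SimplifyingConditions.isBigO_errors (hT : T.SimplifyingConditions k) (hk : 1 ≤ k)
    (hf : ContDiffAt ℝ (2 * k + 2 : ℕ) (fun x : ℝ × Vec d => f x.1 x.2) (t₀, q t₀))
    (hsol : ∀ᶠ t in 𝓝 t₀, HasDerivAt q (v t) t ∧ HasDerivAt v (f t (q t)) t)
    (hφ : Tendsto φ (𝓝 0) (𝓝 fun _ => q t₀))
    (hst : ∀ᶠ h in 𝓝 0, T.IsStages f t₀ (q t₀) (v t₀) h (φ h)) :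
    (fun h => q (t₀ + h) - T.nextPos f t₀ (q t₀) (v t₀) h (φ h))
        =O[𝓝 0] (fun h : ℝ => h ^ (2 * k + 1)) ∧
      ∀ (G : ℝ → Vec d → Vec d) (w : ℝ → Vec d),
        ContDiffAt ℝ (2 * k + 2 : ℕ) (fun x : ℝ × Vec d => G x.1 x.2) (t₀, q t₀) →
        (∀ᶠ t in 𝓝 t₀, HasDerivAt w (G t (q t)) t) →
        (fun h => w (t₀ + h) - (w t₀ + h • ∑ i, T.b i • G (t₀ + T.c i * h) (φ h i)))
          =O[𝓝 0] fun h : ℝ => h ^ (2 * k + 1) := by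
  have hq : ContDiffAt ℝ (2 * k + 2 : ℕ) q t₀ := contDiffAt_solution hf hsol
  have hle : ∀ {n : ℕ}, n ≤ 2 * k + 2 → ((n : ℕ) : WithTop ℕ∞) ≤ (2 * k + 2 : ℕ) := fun h => by
    exact_mod_cast h
  have hφi : ∀ i, Tendsto (fun h => φ h i) (𝓝 0) (𝓝 (q t₀)) := fun i => (tendsto_pi_nhds.1 hφ) i
  let e : Fin s → ℝ → Vec d := fun i h => φ h i - q (t₀ + T.c i * h)
  let g : ℝ → Vec d := fun t => f (t₀ + t) (q (t₀ + t))
  let Δ : Fin s → ℝ → Vec d := fun i h => f (t₀ + T.c i * h) (φ h i) - g (T.c i * h)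
  -- Stated for a general `G`, since it is needed for `f` and again for the field driving `w`.
  have taylor : ∀ {G : ℝ → Vec d → Vec d},
      ContDiffAt ℝ (2 * k + 2 : ℕ) (fun x : ℝ × Vec d => G x.1 x.2) (t₀, q t₀) →
      (∃ a, HasExpansion (fun t => G (t₀ + t) (q (t₀ + t))) 0 a (2 * k)) ∧
      (∃ a, HasExpansion (jacobianAlong (fun x : ℝ × Vec d => G x.1 x.2) t₀ q) 0 a k) ∧
      ∀ i, (fun h => (G (t₀ + T.c i * h) (φ h i) - G (t₀ + T.c i * h) (q (t₀ + T.c i * h)))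
          - jacobianAlong (fun x : ℝ × Vec d => G x.1 x.2) t₀ q (T.c i * h) (e i h))
        =O[𝓝 0] fun h : ℝ => ‖e i h‖ ^ 2 := fun {G} hG =>
    ⟨(contDiffAt_comp_curve (hG.of_le (hle (by omega)))
        (hq.of_le (hle (by omega)))).exists_hasExpansion,
      (contDiffAt_jacobianAlong (n := k) (hG.of_le (hle (by omega)))
        (hq.of_le (hle (by omega)))).exists_hasExpansion,
      fun i => isBigO_linearization (hG.of_le (by exact_mod_cast hle (n := 2) (by omega)))
        hq.continuousAt (hφi i)⟩
  obtain ⟨⟨α, hα⟩, ⟨a, ha⟩, hΔ⟩ := taylor hf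
  have hsol' := eventually_nhds_zero_add hsol
  have hq0 : ∀ᶠ t in 𝓝 (0 : ℝ), HasDerivAt (fun t => q (t₀ + t)) (v (t₀ + t)) t :=
    hsol'.mono fun t ht => ht.1.comp_const_add t₀ t
  have hv0 : ∀ᶠ t in 𝓝 (0 : ℝ), HasDerivAt (fun t => v (t₀ + t)) (g t) t :=
    hsol'.mono fun t ht => ht.2.comp_const_add t₀ t
  have hexp : HasExpansion (fun t => q (t₀ + t) - q (t₀ + 0) - t • v t₀) 2
      (fun l => (((l + 1) * (l + 2) : ℝ))⁻¹ • α l) (2 * k) := by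
    simpa using HasExpansion.integrate_twice hα hq0 hv0
  have hstage : ∀ i, ∀ᶠ h in 𝓝 (0 : ℝ), e i h = h ^ 2 • ∑ j, T.A i j • Δ j h
      - T.defect (fun t => q (t₀ + t)) g (v t₀) i h := by
    intro i
    filter_upwards [hst] with h hh
    simp only [e, Δ, RKNMethod.defect, smul_sub, Finset.sum_sub_distrib, add_zero]
    rw [hh i, mul_comm h (T.c i)]
    abel
  have he0 : ∀ i, e i =O[𝓝 0] fun _ : ℝ => (1 : ℝ) := by
    intro i
    have ht : Tendsto (fun h : ℝ => t₀ + T.c i * h) (𝓝 0) (𝓝 t₀) := by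
      simpa using (tendsto_mul_nhds_zero (T.c i)).const_add t₀
    exact ((hφi i).sub (hq.continuousAt.tendsto.comp ht)).isBigO_one ℝ
  have he : ∀ i, e i =O[𝓝 0] fun h : ℝ => h ^ (k + 1) :=
    isBigO_stage_error hk ha he0 hstage hΔ (isBigO_defect hT hα hexp)
  have hG : ∀ m, (fun h => ∑ i, (T.b i * T.c i ^ m) • e i h)
      =O[𝓝 0] fun h : ℝ => h ^ min (2 * k) (2 * k - m) := fun m => by
    simpa using isBigO_weighted_stage_error hT ha he hstage hΔ
      (isBigO_weighted_defect hT hα hexp) m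
  constructor
  · have hD : ∀ r, (fun h => ∑ i, (T.b i * T.c i ^ r) • Δ i h)
        =O[𝓝 0] fun h : ℝ => h ^ (2 * k - r) := fun r => by
      simpa using isBigO_weighted_sum ha he hΔ le_rfl hG r
    refine (isBigO_update_pos hk hT hα hexp hD).congr_left fun h => ?_
    simp [RKNMethod.nextPos, Δ, g]
  · intro G w hGs hw
    obtain ⟨⟨α', hα'⟩, ⟨a', ha'⟩, hΔ'⟩ := taylor hGs
    have hD := isBigO_weighted_sum ha' he hΔ' le_rfl hG 0
    simp only [Nat.sub_zero, min_self] at hD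
    refine (isBigO_update hT hα' ((eventually_nhds_zero_add hw).mono fun t ht =>
      ht.comp_const_add t₀ t) hD).congr_left fun h => ?_
    simp

/-- Local existence and uniqueness of the stages along `h`. -/
theorem RKNMethod.exists_stage_curve (T : RKNMethod s) {q₀ : Vec d} (v₀ : Vec d)
    (hf : ContDiffAt ℝ 1 (fun x : ℝ × Vec d => f x.1 x.2) (t₀, q₀)) :
    ∃ φ : ℝ → Fin s → Vec d, Tendsto φ (𝓝 0) (𝓝 fun _ => q₀) ∧ ∃ r > 0, ∃ h₀ > 0,
      ∀ h : ℝ, |h| < h₀ → (∀ i, ‖φ h i - q₀‖ < r) ∧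
        ∀ Q : Fin s → Vec d, (∀ i, ‖Q i - q₀‖ < r) →
          (T.IsStages f t₀ q₀ v₀ h Q ↔ φ h = Q) := by
  obtain ⟨φ, hφ, hφ0, hiff⟩ := T.exists_stages v₀ hf
  have hcont : Tendsto (fun h : ℝ => φ (h, q₀, v₀)) (𝓝 0) (𝓝 fun _ => q₀) := by
    rw [← hφ0]
    exact ContinuousAt.comp (g := φ) (f := fun h : ℝ => (h, q₀, v₀)) (x := 0)
      hφ.continuousAt (by fun_prop)
  have hiff' : ∀ᶠ p : ℝ × (Fin s → Vec d) in 𝓝 (0, fun _ => q₀),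
      T.IsStages f t₀ q₀ v₀ p.1 p.2 ↔ φ (p.1, q₀, v₀) = p.2 := by
    have : Tendsto (fun p : ℝ × (Fin s → Vec d) => ((p.1, q₀, v₀), p.2)) (𝓝 (0, fun _ => q₀))
        (𝓝 ((0, q₀, v₀), fun _ => q₀)) := by
      have : Continuous fun p : ℝ × (Fin s → Vec d) => ((p.1, q₀, v₀), p.2) := by fun_prop
      exact this.tendsto _
    exact this.eventually hiff
  obtain ⟨r, hr, hball⟩ := Metric.eventually_nhds_iff_ball.1 hiff'
  obtain ⟨h₀, hh₀, hb⟩ := Metric.eventually_nhds_iff_ball.1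
    (hcont.eventually (Metric.ball_mem_nhds _ hr))
  have hmem : ∀ Q : Fin s → Vec d, dist Q (fun _ => q₀) < r ↔ ∀ i, ‖Q i - q₀‖ < r := fun Q => by
    simp only [dist_pi_lt_iff hr, ← dist_eq_norm]
  -- The bound `h₀` keeps the stage curve in the ball; the bound `r` keeps the pair `(h, Q)` where
  -- uniqueness is known.
  refine ⟨fun h => φ (h, q₀, v₀), hcont, r, hr, min h₀ r, lt_min hh₀ hr, fun h hh => ⟨?_, ?_⟩⟩
  · exact (hmem _).1 (hb h (by simpa using hh.trans_le (min_le_left _ _)))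
  · intro Q hQ
    refine hball (h, Q) ?_
    rw [Metric.mem_ball, Prod.dist_eq]
    exact max_lt (by simpa using hh.trans_le (min_le_right _ _)) ((hmem Q).2 hQ)

/-- Passage from `O`-estimates along the stage curve to the uniform form of the definition of
order. -/
theorem RKNMethod.exists_uniform_bound {q₀ v₀ : Vec d} {T : RKNMethod s} {r h₀ : ℝ} (hr : 0 < r)
    (hh₀ : 0 < h₀) {p : ℕ}
    (hφ : ∀ h : ℝ, |h| < h₀ → (∀ i, ‖φ h i - q₀‖ < r) ∧
        ∀ Q : Fin s → Vec d, (∀ i, ‖Q i - q₀‖ < r) → (T.IsStages f t₀ q₀ v₀ h Q ↔ φ h = Q))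
    {E₁ E₂ : ℝ → (Fin s → Vec d) → Vec d}
    (h₁ : (fun h => E₁ h (φ h)) =O[𝓝 0] fun h : ℝ => h ^ p)
    (h₂ : (fun h => E₂ h (φ h)) =O[𝓝 0] fun h : ℝ => h ^ p) :
    ∃ r > 0, ∃ h₀ > 0, ∃ C : ℝ, ∀ h : ℝ, |h| < h₀ →
      (∃! Q : Fin s → Vec d, (∀ i, ‖Q i - q₀‖ < r) ∧ T.IsStages f t₀ q₀ v₀ h Q) ∧
      ∀ Q : Fin s → Vec d, (∀ i, ‖Q i - q₀‖ < r) → T.IsStages f t₀ q₀ v₀ h Q →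
        ‖E₁ h Q‖ ≤ C * |h| ^ p ∧ ‖E₂ h Q‖ ≤ C * |h| ^ p := by
  obtain ⟨C₁, hC₁⟩ := h₁.bound
  obtain ⟨C₂, hC₂⟩ := h₂.bound
  obtain ⟨h₁, hh₁, hb⟩ := Metric.eventually_nhds_iff_ball.1 (hC₁.and hC₂)
  refine ⟨r, hr, min h₀ h₁, lt_min hh₀ hh₁, max C₁ C₂, fun h hh => ?_⟩
  obtain ⟨hφr, hφQ⟩ := hφ h (hh.trans_le (min_le_left _ _))
  have hb' := hb h (by simpa using hh.trans_le (min_le_right _ _))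
  refine ⟨⟨φ h, ⟨hφr, (hφQ _ hφr).2 rfl⟩, fun Q hQ => ((hφQ Q hQ.1).1 hQ.2).symm⟩, ?_⟩
  intro Q hQr hQ
  obtain rfl := (hφQ Q hQr).1 hQ
  simp only [norm_pow, Real.norm_eq_abs] at hb'
  exact ⟨hb'.1.trans (by gcongr; exact le_max_left _ _),
    hb'.2.trans (by gcongr; exact le_max_right _ _)⟩

theorem RKNMethod.SimplifyingConditions.hasOrder (hT : T.SimplifyingConditions k) (hk : 1 ≤ k) :
    T.HasOrder (2 * k) := by
  -- Enough for the `2k` terms of the expansion along the solution, the `k + 1` derivatives behind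
  -- the Jacobian, and the `C²` linearization.
  refine ⟨2 * k + 2, fun d f t₀ q₀ v₀ hf q v hq₀ hv₀ hsol => ?_⟩
  subst hq₀ hv₀
  obtain ⟨φ, hφ, r, hr, h₀, hh₀, hst⟩ := T.exists_stage_curve (v t₀)
    (hf.of_le (by norm_cast; omega))
  have hev : ∀ᶠ h in 𝓝 (0 : ℝ), T.IsStages f t₀ (q t₀) (v t₀) h (φ h) := by
    filter_upwards [Metric.ball_mem_nhds (0 : ℝ) hh₀] with h hh
    have := hst h (by simpa using hh)
    exact (this.2 _ this.1).2 rfl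
  obtain ⟨hpos, hvel⟩ := hT.isBigO_errors hk hf hsol hφ hev
  exact RKNMethod.exists_uniform_bound hr hh₀ hst
    (E₁ := fun h Q => q (t₀ + h) - T.nextPos f t₀ (q t₀) (v t₀) h Q)
    (E₂ := fun h Q => v (t₀ + h) - T.nextVel f t₀ (v t₀) h Q) hpos
    (hvel f v hf (hsol.mono fun t ht => ht.2))

theorem contDiffAt_gradient {V : Vec d → ℝ} {x : Vec d} {n : ℕ}
    (hV : ContDiffAt ℝ (n + 1 : ℕ) V x) : ContDiffAt ℝ n (gradient V) x :=
  (InnerProductSpace.toDual ℝ (Vec d)).symm.contDiff.contDiffAt.comp x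
    (hV.fderiv_right (by norm_cast))

/-- For singular `M` the momentum cannot be recovered from `q' = M p`, so its error is not a
consequence of the velocity estimate. It is treated as an extra quantity `w` with `w' = -∇V(q)`
attached to the second-order equation for `q`. One more derivative of `V` is required because `f`
contains its gradient. -/
theorem RKNMethod.SimplifyingConditions.hasHamOrder (hT : T.SimplifyingConditions k) (hk : 1 ≤ k) :
    T.HasHamOrder (2 * k) := by
  refine ⟨2 * k + 3, fun d M _ V z₀ hV P q hP₀ hq₀ hsol => ?_⟩
  obtain ⟨p₀, q₀⟩ := z₀
  simp only at hP₀ hq₀ hV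
  subst hP₀ hq₀
  let f : ℝ → Vec d → Vec d := fun _ q => -M.toEuclideanLin (gradient V q)
  let L : Vec d →L[ℝ] Vec d := M.toEuclideanLin.toContinuousLinearMap
  have hgrad : ContDiffAt ℝ (2 * k + 2 : ℕ) (fun x : ℝ × Vec d => -gradient V x.2) (0, q 0) :=
    (ContDiffAt.comp (g := gradient V) (f := Prod.snd) (0, q 0) (contDiffAt_gradient hV)
      contDiffAt_snd).neg
  have hf : ContDiffAt ℝ (2 * k + 2 : ℕ) (fun x : ℝ × Vec d => f x.1 x.2) (0, q 0) := by
    have := L.contDiff.contDiffAt.comp _ hgrad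
    convert this using 2 with x
    simp [f, L]
  have hsol' : ∀ᶠ t in 𝓝 (0 : ℝ), HasDerivAt q (M.toEuclideanLin (P t)) t ∧
      HasDerivAt (fun t => M.toEuclideanLin (P t)) (f t (q t)) t := by
    filter_upwards [hsol] with t ht
    refine ⟨ht.2, ?_⟩
    have := L.hasFDerivAt.comp_hasDerivAt t ht.1
    simpa [L, f] using! this
  obtain ⟨φ, hφ, r, hr, h₀, hh₀, hst⟩ := T.exists_stage_curve (M.toEuclideanLin (P 0))
    (hf.of_le (by norm_cast; omega))
  have hev : ∀ᶠ h in 𝓝 (0 : ℝ), T.IsStages f 0 (q 0) (M.toEuclideanLin (P 0)) h (φ h) := by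
    filter_upwards [Metric.ball_mem_nhds (0 : ℝ) hh₀] with h hh
    have := hst h (by simpa using hh)
    exact (this.2 _ this.1).2 rfl
  obtain ⟨hpos, hmom⟩ := hT.isBigO_errors hk hf hsol' hφ hev
  have hmom' := hmom (fun _ q => -gradient V q) P hgrad (hsol.mono fun t ht => ht.1)
  simp only [zero_add] at hpos hmom'
  exact RKNMethod.exists_uniform_bound hr hh₀ hst
    (E₁ := fun h Q => P h - (T.hamStep M V h (P 0, q 0) Q).1)
    (E₂ := fun h Q => q h - (T.hamStep M V h (P 0, q 0) Q).2) hmom' hpos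

end Order

/-! ### Symplecticity -/

section Symplectic

open Filter

variable {d s : ℕ}

local notation "⟪" x ", " y "⟫" => inner ℝ x y

theorem canonicalForm_eq_inner (u w : Vec d × Vec d) :
    canonicalForm u w = ⟪u.1, w.2⟫ - ⟪w.1, u.2⟫ := by
  simp only [canonicalForm, PiLp.inner_apply, RCLike.inner_apply, conj_trivial,
    ← Finset.sum_sub_distrib]
  exact Finset.sum_congr rfl fun i _ => by ring

/-- The algebraic identity behind symplecticity: `gu`, `gw` stand for the derivatives of the
gradients at the stages and `Ku`, `Kw` for those of the stages, in two directions. -/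
theorem RKNMethod.canonicalForm_step_eq (T : RKNMethod s)
    (hbar : ∀ i, T.bbar i = T.b i * (1 - T.c i))
    (hsymp : ∀ i j, T.b i * (T.bbar j - T.A i j) = T.b j * (T.bbar i - T.A j i))
    {M : Vec d →ₗ[ℝ] Vec d} (hM : ∀ x y, ⟪M x, y⟫ = ⟪x, M y⟫) (h : ℝ) (u w : Vec d × Vec d)
    (gu gw Ku Kw : Fin s → Vec d)
    (hKu : ∀ i, Ku i = u.2 + (h * T.c i) • M u.1 + h ^ 2 • ∑ j, T.A i j • (-M (gu j)))
    (hKw : ∀ i, Kw i = w.2 + (h * T.c i) • M w.1 + h ^ 2 • ∑ j, T.A i j • (-M (gw j)))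
    (hsymm : ∀ i, ⟪gu i, Kw i⟫ = ⟪gw i, Ku i⟫) :
    canonicalForm
      (u.1 + h • ∑ i, T.b i • (-gu i), u.2 + h • M u.1 + h ^ 2 • ∑ i, T.bbar i • (-M (gu i)))
      (w.1 + h • ∑ i, T.b i • (-gw i), w.2 + h • M w.1 + h ^ 2 • ∑ i, T.bbar i • (-M (gw i)))
      = canonicalForm u w := by
  have hM' : ∀ x y, ⟪x, M y⟫ = ⟪y, M x⟫ := fun x y => by rw [← hM, real_inner_comm]
  -- Pair the differentiated stage equations with `gu`, `gw`: by Hessian symmetry the left sides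
  -- cancel, which expresses the terms of first order in `h` through higher ones.
  have hS : ∑ i, T.b i * (⟪gu i, w.2⟫ - ⟪gw i, u.2⟫) =
      ∑ i, T.b i * (-(h * T.c i) * (⟪gu i, M w.1⟫ - ⟪gw i, M u.1⟫)
        + h ^ 2 * ∑ j, T.A i j * (⟪gu i, M (gw j)⟫ - ⟪gw i, M (gu j)⟫)) := by
    refine Finset.sum_congr rfl fun i _ => ?_
    have := hsymm i
    rw [hKu, hKw] at this
    simp only [inner_add_right, inner_smul_right, inner_sum, inner_neg_right, mul_neg,
      Finset.sum_neg_distrib] at this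
    simp only [mul_sub, Finset.sum_sub_distrib]
    linear_combination T.b i * this
  -- The coefficient is symmetric in `i, j` by `hsymp`, the bracket antisymmetric because `M` is
  -- symmetric.
  have hA : ∑ i, ∑ j, T.b i * (T.bbar j - T.A i j) * (⟪gu i, M (gw j)⟫ - ⟪gw i, M (gu j)⟫) = 0 := by
    have h1 : ∀ i j, T.b i * (T.bbar j - T.A i j) * (⟪gu i, M (gw j)⟫ - ⟪gw i, M (gu j)⟫) =
        T.b i * (T.bbar j - T.A i j) * ⟪gu i, M (gw j)⟫
          - T.b j * (T.bbar i - T.A j i) * ⟪gu j, M (gw i)⟫ := fun i j => by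
      rw [hM' (gw i), ← hsymp i j]
      ring
    simp only [h1, Finset.sum_sub_distrib]
    rw [sub_eq_zero, Finset.sum_comm]
  have hX : ∑ i, (T.bbar i + T.b i * T.c i - T.b i) * (⟪gu i, M w.1⟫ - ⟪gw i, M u.1⟫) = 0 :=
    Finset.sum_eq_zero fun i _ => by rw [hbar i]; ring
  simp only [canonicalForm_eq_inner, inner_add_left, inner_add_right, inner_smul_left,
    inner_smul_right, sum_inner, inner_sum, inner_neg_left, inner_neg_right, conj_trivial,
    hM' u.1 (gw _), hM' w.1 (gu _), hM' w.1 u.1]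
  simp only [mul_sub, sub_mul, add_mul, mul_add, Finset.sum_sub_distrib, Finset.sum_add_distrib,
    Finset.mul_sum] at hS hA hX ⊢
  simp only [mul_neg, neg_mul, Finset.sum_neg_distrib] at hS hA hX ⊢
  have e1 : ∀ m : Fin s → Fin s → ℝ, ∑ i, ∑ j, T.b i * (h ^ 2 * (T.A i j * m i j)) =
      h ^ 2 * ∑ i, ∑ j, T.b i * T.A i j * m i j := fun m => by
    simp only [Finset.mul_sum]
    exact Finset.sum_congr rfl fun i _ => Finset.sum_congr rfl fun j _ => by ring
  have e2 : ∀ y : Fin s → ℝ, ∑ i, T.b i * (h * T.c i * y i) = h * ∑ i, T.b i * T.c i * y i :=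
    fun y => by
      rw [Finset.mul_sum]
      exact Finset.sum_congr rfl fun i _ => by ring
  have e3 : ∀ (y : Fin s → ℝ) (m : Fin s → Fin s → ℝ),
      ∑ j, h ^ 2 * (T.bbar j * (y j + -∑ i, h * (T.b i * m i j))) =
        h ^ 2 * ∑ j, T.bbar j * y j - h ^ 3 * ∑ i, ∑ j, T.b i * T.bbar j * m i j := fun y m => by
    rw [Finset.sum_comm]
    simp only [Finset.mul_sum, ← Finset.sum_sub_distrib]
    refine Finset.sum_congr rfl fun j _ => ?_
    rw [mul_add, mul_add, mul_neg, mul_neg, ← sub_eq_add_neg, Finset.mul_sum, Finset.mul_sum]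
    congr 1
    exact Finset.sum_congr rfl fun i _ => by ring
  simp only [e1, e2] at hS
  have e4 := e3 (fun j => ⟪gw j, M u.1⟫) (fun i j => ⟪gu i, M (gw j)⟫)
  have e5 := e3 (fun j => ⟪gu j, M w.1⟫) (fun i j => ⟪gw i, M (gu j)⟫)
  beta_reduce at e4 e5
  rw [e4, e5]
  simp only [← Finset.mul_sum]
  -- Substituting `hS` leaves only terms in `h ^ 2`, killed by the relation for `b̄`, and in `h ^
  -- 3`, killed by the symplecticity condition.
  linear_combination h ^ 3 * hA + h ^ 2 * hX - h * hS

theorem RKNMethod.isSymplectic_of_conditions (T : RKNMethod s)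
    (hbar : ∀ i, T.bbar i = T.b i * (1 - T.c i))
    (hsymp : ∀ i j, T.b i * (T.bbar j - T.A i j) = T.b j * (T.bbar i - T.A j i)) :
    T.IsSymplectic := by
  intro d M hM V W hW hV
  let L : Vec d →L[ℝ] Vec d := M.toEuclideanLin.toContinuousLinearMap
  have hL : ∀ x, M.toEuclideanLin x = L x := fun _ => rfl
  have hLsymm : ∀ x y : Vec d, ⟪M.toEuclideanLin x, y⟫ = ⟪x, M.toEuclideanLin y⟫ :=
    Matrix.isSymmetric_toEuclideanLin_iff.2 (by rw [Matrix.IsHermitian, Matrix.conjTranspose_eq_transpose_of_trivial]; exact hM)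
  have hV2 : ∀ y ∈ W, ContDiffAt ℝ 2 V y := fun y hy => hV.contDiffAt (hW.mem_nhds hy)
  have hgrad : ∀ y ∈ W, ContDiffAt ℝ 1 (gradient V) y := fun y hy =>
    (InnerProductSpace.toDual ℝ (Vec d)).symm.contDiff.contDiffAt.comp y
      ((hV2 y hy).fderiv_right (by norm_num))
  refine ⟨?_, ?_⟩
  · intro h D hD Q hQ hst z hz
    have hQd : ∀ i, HasFDerivAt (fun z => Q z i)
        (.proj i ∘L fderiv ℝ Q z) z := fun i =>
      ((ContinuousLinearMap.proj (R := ℝ) (φ := fun _ : Fin s => Vec d) i).hasFDerivAt).comp z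
        (hQ.differentiableAt (hD.mem_nhds hz)).hasFDerivAt
    let K : Fin s → (Vec d × Vec d) →L[ℝ] Vec d := fun i => .proj i ∘L fderiv ℝ Q z
    let H : Fin s → Vec d →L[ℝ] Vec d := fun i => fderiv ℝ (gradient V) (Q z i)
    let g : Fin s → (Vec d × Vec d) →L[ℝ] Vec d := fun i => H i ∘L K i
    have hg : ∀ i, HasFDerivAt (fun z => gradient V (Q z i)) (g i) z := fun i =>
      HasFDerivAt.comp (g := gradient V) z
        ((hgrad _ ((hst z hz).1 i)).differentiableAt one_ne_zero).hasFDerivAt (hQd i)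
    have hMg : ∀ i, HasFDerivAt (fun z => -L (gradient V (Q z i))) (-(L ∘L g i)) z := fun i =>
      (L.hasFDerivAt.comp z (hg i)).neg
    have hMp : HasFDerivAt (fun z : Vec d × Vec d => L z.1) (L ∘L .fst ℝ _ _) z :=
      L.hasFDerivAt.comp z hasFDerivAt_fst
    have hpos : ∀ (r : ℝ) (a : Fin s → ℝ), HasFDerivAt
        (fun z : Vec d × Vec d => z.2 + r • L z.1 + h ^ 2 • ∑ j, a j • -L (gradient V (Q z j)))
        (.snd ℝ _ _ + r • (L ∘L .fst ℝ _ _) + h ^ 2 • ∑ j, a j • (-(L ∘L g j))) z := fun r a =>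
      (hasFDerivAt_snd.add (hMp.const_smul r)).add
        ((HasFDerivAt.fun_sum fun j _ => (hMg j).const_smul (a j)).const_smul (h ^ 2))
    -- The stage equations hold on the open set `D`, so they may be differentiated; no smallness of
    -- `h` is involved.
    have hK : ∀ i, K i = ContinuousLinearMap.snd ℝ _ _ + (h * T.c i) • (L ∘L .fst ℝ _ _)
        + h ^ 2 • ∑ j, T.A i j • (-(L ∘L g j)) := fun i => by
      refine (hQd i).unique ((hpos (h * T.c i) (T.A i)).congr_of_eventuallyEq ?_)
      filter_upwards [hD.mem_nhds hz] with z' hz'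
      exact (hst z' hz').2 i
    have hstep : HasFDerivAt (fun z => T.hamStep M V h z (Q z))
        ((ContinuousLinearMap.fst ℝ _ _ + h • ∑ j, T.b j • (-(g j))).prod
          (ContinuousLinearMap.snd ℝ _ _ + h • (L ∘L .fst ℝ _ _) + h ^ 2 • ∑ j, T.bbar j • (-(L ∘L g j)))) z :=
      (hasFDerivAt_fst.add ((HasFDerivAt.fun_sum fun j _ =>
        ((hg j).neg).const_smul (T.b j)).const_smul h)).prodMk (hpos h T.bbar)
    -- Through the inner product, the derivative of the gradient is the second derivative of `V`,
    -- symmetric by Schwarz.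
    have hHsymm : ∀ i x y, ⟪H i x, y⟫ = ⟪H i y, x⟫ := by
      intro i x y
      have hy := (hst z hz).1 i
      have h1 : DifferentiableAt ℝ (fderiv ℝ V) (Q z i) :=
        ((hV2 _ hy).fderiv_right (m := 1) (by norm_num)).differentiableAt one_ne_zero
      have h3 : ∀ x y, ⟪H i x, y⟫ = fderiv ℝ (fderiv ℝ V) (Q z i) x y := fun x y => by
        have h4 : HasFDerivAt (fun a => ⟪gradient V a, y⟫) _ (Q z i) :=
          ((hgrad _ hy).differentiableAt one_ne_zero).hasFDerivAt.inner ℝ (hasFDerivAt_const y _)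
        have h5 : HasFDerivAt (fun a => fderiv ℝ V a y) _ (Q z i) :=
          h1.hasFDerivAt.clm_apply (hasFDerivAt_const y _)
        simp only [inner_gradient_left] at h4
        simpa using congrArg (fun A : Vec d →L[ℝ] ℝ => A x) (h4.unique h5)
      rw [h3, h3]
      refine second_derivative_symmetric_of_eventually_of_real (f := V) (f' := fderiv ℝ V) ?_
        h1.hasFDerivAt x y
      filter_upwards [hW.mem_nhds hy] with y hy
      exact ((hV2 y hy).differentiableAt two_ne_zero).hasFDerivAt
    refine ⟨hstep.differentiableAt, fun u w => ?_⟩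
    rw [hstep.fderiv]
    have := T.canonicalForm_step_eq hbar hsymp (M := M.toEuclideanLin) hLsymm h u w
      (fun i => g i u) (fun i => g i w) (fun i => K i u) (fun i => K i w)
      (fun i => by rw [hK i]; simp [hL, sum_apply]) (fun i => by rw [hK i]; simp [hL, sum_apply])
      (fun i => hHsymm i _ _)
    simpa [hL, sum_apply] using this
  · intro z₀ hz₀
    have hf : ContDiffAt ℝ 1
        (fun x : ℝ × Vec d => (fun _ q => -M.toEuclideanLin (gradient V q)) x.1 x.2)
        ((0 : ℝ), z₀.2) :=
      (L.contDiff.contDiffAt.comp _ (ContDiffAt.comp (g := gradient V) (f := Prod.snd)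
        ((0 : ℝ), z₀.2) (hgrad _ hz₀) contDiffAt_snd)).neg
    obtain ⟨φ, hφ, hφ0, hiff⟩ := T.exists_stages
      (f := fun _ q => -M.toEuclideanLin (gradient V q)) (M.toEuclideanLin z₀.1) hf
    -- Translates `(h, (p, q))` into step size, position and initial velocity `M p`.
    let ψ : ℝ × (Vec d × Vec d) → ℝ × Vec d × Vec d := fun x => (x.1, x.2.2, L x.2.1)
    have hψ : Continuous ψ := by fun_prop
    have hψd : ∀ h : ℝ, Differentiable ℝ fun z => ψ (h, z) := fun h => by fun_prop
    have hcont : Tendsto (fun x => φ (ψ x)) (𝓝 (0, z₀)) (𝓝 fun _ => z₀.2) := by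
      rw [← hφ0]
      exact ContinuousAt.comp (g := φ) (f := ψ) (x := (0, z₀)) hφ.continuousAt hψ.continuousAt
    have hdiff : ∀ᶠ x in 𝓝 ((0 : ℝ), z₀), DifferentiableAt ℝ φ (ψ x) :=
      (hψ.tendsto ((0 : ℝ), z₀)).eventually
        ((hφ.eventually (by simp)).mono fun x hx => hx.differentiableAt one_ne_zero)
    have hiff' : ∀ᶠ p : (ℝ × (Vec d × Vec d)) × (Fin s → Vec d) in 𝓝 ((0, z₀), fun _ => z₀.2),
        T.IsHamStages M V p.1.1 p.1.2 p.2 ↔ φ (ψ p.1) = p.2 := by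
      have : Continuous fun p : (ℝ × (Vec d × Vec d)) × (Fin s → Vec d) => (ψ p.1, p.2) := by
        fun_prop
      exact (this.tendsto ((0, z₀), fun _ => z₀.2)).eventually hiff
    obtain ⟨r₁, hr₁, hball⟩ := Metric.eventually_nhds_iff_ball.1 hiff'
    obtain ⟨r₂, hr₂, hballW⟩ := Metric.isOpen_iff.1 hW _ hz₀
    have hr : 0 < min r₁ r₂ := lt_min hr₁ hr₂
    obtain ⟨ρ, hρ, hb⟩ := Metric.eventually_nhds_iff_ball.1
      ((hcont.eventually (Metric.ball_mem_nhds _ hr)).and hdiff)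
    refine ⟨min r₁ r₂, hr, min ρ r₁, lt_min hρ hr₁, Metric.ball z₀ (min ρ r₁), Metric.isOpen_ball,
      Metric.mem_ball_self (lt_min hρ hr₁),
      (Metric.ball_subset_ball (min_le_right _ _)).trans hballW, fun h hh => ?_⟩
    have hmem : ∀ z ∈ Metric.ball z₀ (min ρ r₁), dist (h, z) ((0 : ℝ), z₀) < min ρ r₁ :=
      fun z hz => by
        rw [Prod.dist_eq]
        exact max_lt (by simpa using hh) hz
    have hmemQ : ∀ Q : Fin s → Vec d, (∀ i, Q i ∈ Metric.ball z₀.2 (min r₁ r₂)) →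
        dist Q (fun _ => z₀.2) < min r₁ r₂ := fun Q hQ => (dist_pi_lt_iff hr).2 hQ
    have hiffz : ∀ z ∈ Metric.ball z₀ (min ρ r₁), ∀ Q : Fin s → Vec d,
        (∀ i, Q i ∈ Metric.ball z₀.2 (min r₁ r₂)) →
        (T.IsHamStages M V h z Q ↔ φ (ψ (h, z)) = Q) := fun z hz Q hQ => by
      refine hball ((h, z), Q) ?_
      rw [Metric.mem_ball, Prod.dist_eq]
      exact max_lt ((hmem z hz).trans_le (min_le_right _ _))
        ((hmemQ Q hQ).trans_le (min_le_left _ _))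
    refine ⟨fun z => φ (ψ (h, z)), fun z hz => ?_, fun z hz => ?_⟩
    · have := (hb (h, z) ((hmem z hz).trans_le (min_le_left _ _))).2
      exact (DifferentiableAt.comp (g := φ) (f := fun z => ψ (h, z)) z this
        (hψd h z)).differentiableWithinAt
    · have h1 : ∀ i, φ (ψ (h, z)) i ∈ Metric.ball z₀.2 (min r₁ r₂) :=
        (dist_pi_lt_iff hr).1 (hb (h, z) ((hmem z hz).trans_le (min_le_left _ _))).1
      exact ⟨h1, (hiffz z hz _ h1).2 rfl, fun Q' hQ' hst => ((hiffz z hz Q' hQ').1 hst).symm⟩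

end Symplectic

/-! ### Gauss discretizations -/

section Gauss

variable {s : ℕ} {T : RKNMethod s}

theorem RKNMethod.isGauss_of_moments (hc : StrictMono T.c)
    (h : ∀ r < 2 * s, ∑ i, T.b i * T.c i ^ r = 1 / (r + 1)) : T.IsGauss := by
  refine ⟨hc, fun g hg => ?_⟩
  simp only [Polynomial.eval_eq_sum_range' hg, Finset.mul_sum]
  rw [Finset.sum_comm, intervalIntegral.integral_finsetSum
    fun r _ => (by fun_prop : Continuous fun x : ℝ => g.coeff r * x ^ r).intervalIntegrable _ _]
  refine Finset.sum_congr rfl fun r hr => ?_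
  rw [intervalIntegral.integral_const_mul, integral_pow]
  have := h r (Finset.mem_range.1 hr)
  simp only [one_pow, ne_eq, Nat.succ_ne_zero, not_false_eq_true, zero_pow, sub_zero]
  rw [← this, Finset.mul_sum]
  exact Finset.sum_congr rfl fun i _ => by ring

theorem RKNMethod.IsGauss.moment (h : T.IsGauss) {r : ℕ} (hr : r < 2 * s) :
    ∑ i, T.b i * T.c i ^ r = 1 / (r + 1) := by
  have := h.2 (Polynomial.X ^ r) (by simpa using hr)
  simpa using this

variable {Abar : ℝ → ℝ → ℝ}

/-- With `āᵢⱼ = bⱼ Ā(cᵢ, cⱼ)`, the two sides of the symplecticity condition differ by `bᵢ bⱼ` times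
the antisymmetry relation at `(cᵢ, cⱼ)`. -/
theorem RKNMethod.IsGaussDiscretization.isSymplectic (h : T.IsGaussDiscretization Abar)
    (hanti : ∀ τ σ, Abar τ σ - Abar σ τ = τ - σ) : T.IsSymplectic := by
  obtain ⟨-, hA, hbar⟩ := h
  refine T.isSymplectic_of_conditions hbar fun i j => ?_
  rw [hA, hA, hbar, hbar]
  linear_combination -T.b i * T.b j * hanti (T.c i) (T.c j)

/-- A Gauss discretization satisfies the simplifying conditions as soon as `Ā(τ, ·)` is a polynomial
`∑ a n τ * σ ^ n` of degree at most `s` with `∫ Ā(τ, σ) σ ^ r dσ = τ ^ (r+2) / ((r+1) (r+2))` for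
`r + 1 < s`, and `Ā(τ, σ) - Ā(σ, τ) = τ - σ`. -/
theorem RKNMethod.IsGaussDiscretization.simplifyingConditions (h : T.IsGaussDiscretization Abar)
    (hanti : ∀ τ σ, Abar τ σ - Abar σ τ = τ - σ) {a : ℕ → ℝ → ℝ}
    (ha : ∀ τ σ, Abar τ σ = ∑ n ∈ Finset.range (s + 1), a n τ * σ ^ n)
    (hint : ∀ r, r + 1 < s → ∀ τ, ∑ n ∈ Finset.range (s + 1), a n τ / (n + r + 1) =
      τ ^ (r + 2) / ((r + 1) * (r + 2))) : T.SimplifyingConditions s := by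
  obtain ⟨hG, hA, hbar⟩ := h
  -- The integrand has degree at most `s + (s - 2)` in `σ`, within the exactness of Gauss
  -- quadrature.
  have key : ∀ r, r + 1 < s → ∀ τ, ∑ j, T.b j * Abar τ (T.c j) * T.c j ^ r =
      τ ^ (r + 2) / ((r + 1) * (r + 2)) := by
    intro r hr τ
    rw [← hint r hr τ]
    simp only [ha, Finset.mul_sum, Finset.sum_mul]
    rw [Finset.sum_comm]
    refine Finset.sum_congr rfl fun n hn => ?_
    rw [Finset.mem_range] at hn
    have := hG.moment (r := n + r) (by omega)
    push_cast at this
    rw [div_eq_mul_one_div, ← this, Finset.mul_sum]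
    exact Finset.sum_congr rfl fun j _ => by ring
  refine ⟨fun r hr => hG.moment hr, fun r hr i => ?_, fun m hm j => ?_, hbar⟩
  · simp only [hA]
    exact key r hr _
  · have h0 := hG.moment (r := m) (by omega)
    have h1 := hG.moment (r := m + 1) (by omega)
    -- Antisymmetry exchanges the arguments of `Ā`, turning a column sum into the row sum of `key`
    -- plus two moments.
    have h2 : ∑ i, T.b i * T.c i ^ m * T.A i j = T.b j *
        (∑ i, T.b i * Abar (T.c j) (T.c i) * T.c i ^ m + ∑ i, T.b i * T.c i ^ (m + 1)
          - T.c j * ∑ i, T.b i * T.c i ^ m) := by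
      rw [Finset.mul_sum, ← Finset.sum_add_distrib, ← Finset.sum_sub_distrib, Finset.mul_sum]
      refine Finset.sum_congr rfl fun i _ => ?_
      rw [hA]
      linear_combination T.b i * T.c i ^ m * T.b j * hanti (T.c i) (T.c j)
    rw [h2, key m hm, h0, h1]
    push_cast
    ring

end Gauss

/-! ### The Legendre coefficients -/

theorem eval_legendreP_zero (t : ℝ) : (legendreP 0).eval t = 1 := by
  simp [legendreP]

theorem eval_legendreP_one (t : ℝ) : (legendreP 1).eval t = √3 * (2 * t - 1) := by
  simp [legendreP]
  norm_num

/-- Expanding the power lets the derivatives in the Rodrigues formula be taken monomial by monomial.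
-/
theorem sq_sub_self_sq {R : Type*} [CommRing R] (x : R) :
    (x ^ 2 - x) ^ 2 = x ^ 4 - 2 * x ^ 3 + x ^ 2 := by ring

theorem sq_sub_self_pow_three {R : Type*} [CommRing R] (x : R) :
    (x ^ 2 - x) ^ 3 = x ^ 6 - 3 * x ^ 5 + 3 * x ^ 4 - x ^ 3 := by ring

theorem sq_sub_self_pow_four {R : Type*} [CommRing R] (x : R) :
    (x ^ 2 - x) ^ 4 = x ^ 8 - 4 * x ^ 7 + 6 * x ^ 6 - 4 * x ^ 5 + x ^ 4 := by ring

theorem eval_legendreP_two (t : ℝ) : (legendreP 2).eval t = √5 * (6 * t ^ 2 - 6 * t + 1) := by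
  have h : ((Polynomial.X ^ 2 - Polynomial.X) ^ 2 : ℝ[X]) =
      Polynomial.X ^ 4 - Polynomial.C 2 * Polynomial.X ^ 3 + Polynomial.X ^ 2 := by
    simp only [map_ofNat]
    exact sq_sub_self_sq _
  have h5 : (2 * (2 : ℕ) + 1 : ℝ) = 5 := by norm_num
  rw [legendreP, h, h5]
  simp only [iterate_map_add, Polynomial.iterate_derivative_sub,
    Polynomial.iterate_derivative_C_mul, Polynomial.iterate_derivative_X_pow_eq_natCast_mul,
    Polynomial.eval_mul, Polynomial.eval_add, Polynomial.eval_sub, Polynomial.eval_C,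
    Polynomial.eval_natCast, Polynomial.eval_pow, Polynomial.eval_X]
  norm_num [Nat.descFactorial, Nat.factorial]
  ring

theorem eval_legendreP_three (t : ℝ) :
    (legendreP 3).eval t = √7 * (20 * t ^ 3 - 30 * t ^ 2 + 12 * t - 1) := by
  have h : ((Polynomial.X ^ 2 - Polynomial.X) ^ 3 : ℝ[X]) =
      Polynomial.X ^ 6 - Polynomial.C 3 * Polynomial.X ^ 5 + Polynomial.C 3 * Polynomial.X ^ 4
        - Polynomial.X ^ 3 := by
    simp only [map_ofNat]
    exact sq_sub_self_pow_three _
  have h7 : (2 * (3 : ℕ) + 1 : ℝ) = 7 := by norm_num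
  rw [legendreP, h, h7]
  simp only [iterate_map_add, Polynomial.iterate_derivative_sub,
    Polynomial.iterate_derivative_C_mul, Polynomial.iterate_derivative_X_pow_eq_natCast_mul,
    Polynomial.eval_mul, Polynomial.eval_add, Polynomial.eval_sub, Polynomial.eval_C,
    Polynomial.eval_natCast, Polynomial.eval_pow, Polynomial.eval_X]
  norm_num [Nat.descFactorial, Nat.factorial]
  ring

theorem eval_legendreP_four (t : ℝ) :
    (legendreP 4).eval t = 3 * (70 * t ^ 4 - 140 * t ^ 3 + 90 * t ^ 2 - 20 * t + 1) := by
  have h : ((Polynomial.X ^ 2 - Polynomial.X) ^ 4 : ℝ[X]) =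
      Polynomial.X ^ 8 - Polynomial.C 4 * Polynomial.X ^ 7 + Polynomial.C 6 * Polynomial.X ^ 6
        - Polynomial.C 4 * Polynomial.X ^ 5 + Polynomial.X ^ 4 := by
    simp only [map_ofNat]
    exact sq_sub_self_pow_four _
  have h9 : √(2 * (4 : ℕ) + 1 : ℝ) = 3 := by
    rw [show (2 * (4 : ℕ) + 1 : ℝ) = 3 ^ 2 by norm_num, Real.sqrt_sq (by norm_num)]
  rw [legendreP, h, h9]
  simp only [iterate_map_add, Polynomial.iterate_derivative_sub,
    Polynomial.iterate_derivative_C_mul, Polynomial.iterate_derivative_X_pow_eq_natCast_mul,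
    Polynomial.eval_mul, Polynomial.eval_add, Polynomial.eval_sub, Polynomial.eval_C,
    Polynomial.eval_natCast, Polynomial.eval_pow, Polynomial.eval_X]
  norm_num [Nat.descFactorial, Nat.factorial]
  ring

theorem legendreXi_one : legendreXi 1 = √3 / 6 := by
  have h3 : √(3 : ℝ) ^ 2 = 3 := Real.sq_sqrt (by norm_num)
  have : (4 * ((1 : ℕ) : ℝ) ^ 2 - 1) = 3 := by norm_num
  rw [legendreXi, this]
  field_simp
  linear_combination -2 * h3

theorem legendreXi_two : legendreXi 2 = √3 * √5 / 30 := by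
  have h3 : √(3 : ℝ) ^ 2 = 3 := Real.sq_sqrt (by norm_num)
  have h5 : √(5 : ℝ) ^ 2 = 5 := Real.sq_sqrt (by norm_num)
  have : (4 * ((2 : ℕ) : ℝ) ^ 2 - 1) = 3 * 5 := by norm_num
  rw [legendreXi, this, Real.sqrt_mul (by norm_num)]
  field_simp
  linear_combination -2 * √5 ^ 2 * h3 - 6 * h5

theorem legendreXi_three : legendreXi 3 = √5 * √7 / 70 := by
  have h5 : √(5 : ℝ) ^ 2 = 5 := Real.sq_sqrt (by norm_num)
  have h7 : √(7 : ℝ) ^ 2 = 7 := Real.sq_sqrt (by norm_num)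
  have : (4 * ((3 : ℕ) : ℝ) ^ 2 - 1) = 5 * 7 := by norm_num
  rw [legendreXi, this, Real.sqrt_mul (by norm_num)]
  field_simp
  linear_combination -2 * √7 ^ 2 * h5 - 10 * h7

theorem legendreXi_four : legendreXi 4 = √7 / 42 := by
  have h7 : √(7 : ℝ) ^ 2 = 7 := Real.sq_sqrt (by norm_num)
  have : (4 * ((4 : ℕ) : ℝ) ^ 2 - 1) = 3 ^ 2 * 7 := by norm_num
  rw [legendreXi, this, Real.sqrt_mul (by norm_num), Real.sqrt_sq (by norm_num)]
  field_simp
  linear_combination -6 * h7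

/-- The square roots in `ξ_n` cancel against the normalizations `√(2n+1)`, so that only rational
coefficients and `θ` remain. -/
theorem csCoeff_two (θ τ σ : ℝ) : csCoeff 2 θ τ σ =
    1 / 6 - (2 * σ - 1) / 4 + (2 * τ - 1) / 4
      + ((6 * σ ^ 2 - 6 * σ + 1) + (6 * τ ^ 2 - 6 * τ + 1)) / 12
      + 3 * θ * ((2 * τ - 1) * (2 * σ - 1)) := by
  have h3 : √(3 : ℝ) ^ 2 = 3 := Real.sq_sqrt (by norm_num)
  have h5 : √(5 : ℝ) ^ 2 = 5 := Real.sq_sqrt (by norm_num)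
  simp only [csCoeff, show Finset.Icc 1 (2 - 1) = {1} from rfl,
    show Finset.Icc 1 (2 - 2) = (∅ : Finset ℕ) from rfl, Finset.sum_singleton, Finset.sum_empty,
    Nat.reduceAdd, Nat.reduceSub, legendreXi_one, legendreXi_two, eval_legendreP_zero,
    eval_legendreP_one, eval_legendreP_two]
  ring_nf
  simp only [h3, h5]
  ring

theorem csCoeff_three (θ τ σ : ℝ) : csCoeff 3 θ τ σ =
    1 / 6 - (2 * σ - 1) / 4 + (2 * τ - 1) / 4
      + ((6 * σ ^ 2 - 6 * σ + 1) + (6 * τ ^ 2 - 6 * τ + 1)) / 12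
      + ((2 * τ - 1) * (20 * σ ^ 3 - 30 * σ ^ 2 + 12 * σ - 1)
        + (20 * τ ^ 3 - 30 * τ ^ 2 + 12 * τ - 1) * (2 * σ - 1)) / 20
      - 3 / 10 * ((2 * τ - 1) * (2 * σ - 1))
      + 5 * θ * ((6 * τ ^ 2 - 6 * τ + 1) * (6 * σ ^ 2 - 6 * σ + 1)) := by
  have h3 : √(3 : ℝ) ^ 2 = 3 := Real.sq_sqrt (by norm_num)
  have h5 : √(5 : ℝ) ^ 2 = 5 := Real.sq_sqrt (by norm_num)
  have h7 : √(7 : ℝ) ^ 2 = 7 := Real.sq_sqrt (by norm_num)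
  have h34 : √(3 : ℝ) ^ 4 = 9 := by rw [pow_mul (√3) 2 2, h3]; norm_num
  simp only [csCoeff, show Finset.Icc 1 (3 - 1) = {1, 2} from rfl,
    show Finset.Icc 1 (3 - 2) = {1} from rfl, Finset.sum_singleton,
    Finset.sum_pair (show (1 : ℕ) ≠ 2 by decide), Nat.reduceAdd, Nat.reduceSub, legendreXi_one,
    legendreXi_two, legendreXi_three, eval_legendreP_zero, eval_legendreP_one, eval_legendreP_two,
    eval_legendreP_three]
  ring_nf
  simp only [h3, h5, h7, h34]
  ring

theorem csCoeff_four (θ τ σ : ℝ) : csCoeff 4 θ τ σ =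
    1 / 6 - (2 * σ - 1) / 4 + (2 * τ - 1) / 4
      + ((6 * σ ^ 2 - 6 * σ + 1) + (6 * τ ^ 2 - 6 * τ + 1)) / 12
      + ((2 * τ - 1) * (20 * σ ^ 3 - 30 * σ ^ 2 + 12 * σ - 1)
        + (20 * τ ^ 3 - 30 * τ ^ 2 + 12 * τ - 1) * (2 * σ - 1)) / 20
      + ((6 * τ ^ 2 - 6 * τ + 1) * (70 * σ ^ 4 - 140 * σ ^ 3 + 90 * σ ^ 2 - 20 * σ + 1)
        + (70 * τ ^ 4 - 140 * τ ^ 3 + 90 * τ ^ 2 - 20 * τ + 1) * (6 * σ ^ 2 - 6 * σ + 1)) / 28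
      - 3 / 10 * ((2 * τ - 1) * (2 * σ - 1))
      - 5 / 42 * ((6 * τ ^ 2 - 6 * τ + 1) * (6 * σ ^ 2 - 6 * σ + 1))
      + 7 * θ * ((20 * τ ^ 3 - 30 * τ ^ 2 + 12 * τ - 1)
        * (20 * σ ^ 3 - 30 * σ ^ 2 + 12 * σ - 1)) := by
  have h3 : √(3 : ℝ) ^ 2 = 3 := Real.sq_sqrt (by norm_num)
  have h5 : √(5 : ℝ) ^ 2 = 5 := Real.sq_sqrt (by norm_num)
  have h7 : √(7 : ℝ) ^ 2 = 7 := Real.sq_sqrt (by norm_num)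
  have h34 : √(3 : ℝ) ^ 4 = 9 := by rw [pow_mul (√3) 2 2, h3]; norm_num
  have h54 : √(5 : ℝ) ^ 4 = 25 := by rw [pow_mul (√5) 2 2, h5]; norm_num
  simp only [csCoeff, show Finset.Icc 1 (4 - 1) = {1, 2, 3} from rfl,
    show Finset.Icc 1 (4 - 2) = {1, 2} from rfl,
    Finset.sum_insert (show (1 : ℕ) ∉ ({2, 3} : Finset ℕ) by decide),
    Finset.sum_pair (show (1 : ℕ) ≠ 2 by decide), Finset.sum_pair (show (2 : ℕ) ≠ 3 by decide),
    Nat.reduceAdd, Nat.reduceSub, legendreXi_one, legendreXi_two, legendreXi_three, legendreXi_four,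
    eval_legendreP_zero, eval_legendreP_one, eval_legendreP_two, eval_legendreP_three,
    eval_legendreP_four]
  -- treat the Legendre factors as atoms
  generalize (2 * τ - 1) = p₁, (2 * σ - 1) = q₁, (6 * τ ^ 2 - 6 * τ + 1) = p₂,
    (6 * σ ^ 2 - 6 * σ + 1) = q₂, (20 * τ ^ 3 - 30 * τ ^ 2 + 12 * τ - 1) = p₃,
    (20 * σ ^ 3 - 30 * σ ^ 2 + 12 * σ - 1) = q₃,
    (70 * τ ^ 4 - 140 * τ ^ 3 + 90 * τ ^ 2 - 20 * τ + 1) = p₄,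
    (70 * σ ^ 4 - 140 * σ ^ 3 + 90 * σ ^ 2 - 20 * σ + 1) = q₄
  ring_nf
  simp only [h3, h5, h7, h34, h54]
  ring

/-! ### The three families -/

theorem isGaussDiscretization_family4 (θ : ℝ) :
    (family4 θ).IsGaussDiscretization (csCoeff 2 θ) := by
  have h3 : √(3 : ℝ) ^ 2 = 3 := Real.sq_sqrt (by norm_num)
  have hpos : 0 < √(3 : ℝ) := by positivity
  refine ⟨RKNMethod.isGauss_of_moments ?_ ?_, ?_, ?_⟩
  · rw [Fin.strictMono_iff_lt_succ]
    intro i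
    fin_cases i
    simp only [family4]
    norm_num
    linarith
  · intro r hr
    simp only [family4, Fin.sum_univ_two, Matrix.cons_val_zero, Matrix.cons_val_one]
    interval_cases r <;> norm_num <;> grind
  · intro i j
    fin_cases i <;> fin_cases j <;> simp [family4, csCoeff_two] <;> grind
  · intro i
    fin_cases i <;> simp [family4] <;> grind

theorem isGaussDiscretization_family6 (θ : ℝ) :
    (family6 θ).IsGaussDiscretization (csCoeff 3 θ) := by
  have h3 : √(15 : ℝ) ^ 2 = 15 := Real.sq_sqrt (by norm_num)
  have hpos : 0 < √(15 : ℝ) := by positivity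
  refine ⟨RKNMethod.isGauss_of_moments ?_ ?_, ?_, ?_⟩
  · rw [Fin.strictMono_iff_lt_succ]
    intro i
    fin_cases i <;> simp [family6] <;> linarith
  · intro r hr
    simp only [family6, Fin.sum_univ_three, Matrix.cons_val_zero, Matrix.cons_val_one,
      Matrix.cons_val_two]
    interval_cases r <;> norm_num <;> grind
  · intro i j
    fin_cases i <;> fin_cases j <;> simp [family6, csCoeff_three] <;> grind
  · intro i
    fin_cases i <;> simp [family6] <;> grind

/-- Makes the radicand of `n` positive. -/
theorem sqrt_seventy_lt : 70 * √(30 : ℝ) < 525 := by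
  have : √(30 : ℝ) < 7.5 := by
    rw [Real.sqrt_lt' (by norm_num)]
    norm_num
  linarith

/-- The radicals of the four-stage family in terms of `√30`, `m` and `n`. -/
theorem radicals_family8 {x m n : ℝ} (hx : x = √30) (hm : m = √(525 + 70 * √30))
    (hn : n = √(525 - 70 * √30)) :
    x ^ 2 = 30 ∧ m ^ 2 = 525 + 70 * x ∧ n ^ 2 = 525 - 70 * x ∧ 0 < n ∧ n < m ∧
      √(630 + 84 * √30) = x * m / 5 ∧ √(630 - 84 * √30) = x * n / 5 ∧
      √105 = m * n / 35 ∧ √14 = x * m * n / 525 := by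
  have hlt := sqrt_seventy_lt
  rw [← hx] at hlt hm hn ⊢
  have hx0 : 0 < x := by rw [hx]; positivity
  have hx2 : x ^ 2 = 30 := by rw [hx]; exact Real.sq_sqrt (by norm_num)
  have hm0 : 0 < m := by rw [hm]; positivity
  have hn0 : 0 < n := by rw [hn]; exact Real.sqrt_pos.2 (by linarith)
  have hm2 : m ^ 2 = 525 + 70 * x := by rw [hm]; exact Real.sq_sqrt (by positivity)
  have hn2 : n ^ 2 = 525 - 70 * x := by rw [hn]; exact Real.sq_sqrt (by linarith)
  refine ⟨hx2, hm2, hn2, hn0, ?_, ?_, ?_, ?_, ?_⟩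
  · exact lt_of_pow_lt_pow_left₀ 2 hm0.le (by rw [hm2, hn2]; linarith)
  · rw [show 630 + 84 * x = (x * m / 5) ^ 2 by grind, Real.sqrt_sq (by positivity)]
  · rw [show 630 - 84 * x = (x * n / 5) ^ 2 by grind, Real.sqrt_sq (by positivity)]
  · rw [show (105 : ℝ) = (m * n / 35) ^ 2 by grind, Real.sqrt_sq (by positivity)]
  · rw [show (14 : ℝ) = (x * m * n / 525) ^ 2 by grind, Real.sqrt_sq (by positivity)]

/-- The coefficient at two nodes `(35 + ε) / 70` of the four-point Gauss quadrature. -/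
theorem csCoeff_four_nodes {α β ε η : ℝ} (θ : ℝ) (hα : α ^ 2 = 30) (hβ : β ^ 2 = 30)
    (hε : ε ^ 2 = 525 + 70 * α) (hη : η ^ 2 = 525 + 70 * β) :
    csCoeff 4 θ ((35 + ε) / 70) ((35 + η) / 70) =
      1 / 6 - η / 140 + ε / 140 + (2 / 7 + 3 * (α + β) / 35) / 12
        + ε * η * (α + β - 6) / 171500 - 3 / 12250 * (ε * η)
        - 5 / 42 * ((1 / 7 + 3 * α / 35) * (1 / 7 + 3 * β / 35))
        + θ * (ε * η * ((α - 3) * (β - 3))) / 8575 := by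
  have h2 : ∀ {α ε : ℝ}, ε ^ 2 = 525 + 70 * α →
      6 * ((35 + ε) / 70) ^ 2 - 6 * ((35 + ε) / 70) + 1 = 1 / 7 + 3 * α / 35 := fun h => by
    linear_combination 6 / 4900 * h
  have h3 : ∀ {α ε : ℝ}, ε ^ 2 = 525 + 70 * α →
      20 * ((35 + ε) / 70) ^ 3 - 30 * ((35 + ε) / 70) ^ 2 + 12 * ((35 + ε) / 70) - 1 =
        ε * (α - 3) / 245 := fun {α ε} h => by
    linear_combination 20 / 343000 * ε * h
  -- The nodes are the zeros of `P_4`, so the quartic terms drop out.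
  have h4 : ∀ {α ε : ℝ}, α ^ 2 = 30 → ε ^ 2 = 525 + 70 * α →
      70 * ((35 + ε) / 70) ^ 4 - 140 * ((35 + ε) / 70) ^ 3 + 90 * ((35 + ε) / 70) ^ 2
        - 20 * ((35 + ε) / 70) + 1 = 0 := fun {α ε} h h' => by
    grind
  have h1 : ∀ ε : ℝ, 2 * ((35 + ε) / 70) - 1 = ε / 35 := fun ε => by ring
  rw [csCoeff_four, h1, h1, h2 hε, h2 hη, h3 hε, h3 hη, h4 hα hε, h4 hβ hη]
  ring

theorem isGaussDiscretization_family8 (θ : ℝ) :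
    (family8 θ).IsGaussDiscretization (csCoeff 4 θ) := by
  obtain ⟨hx2, hm2, hn2, hn0, hmn, hu, hw, hz, hy⟩ := radicals_family8 rfl rfl rfl
  -- A copy of the table in which every radical is expressed through `x`, `m`, `n`, so that these
  -- can become free variables subject to three polynomial relations.
  have hT : family8 θ = family8 θ := rfl
  conv_rhs at hT => simp only [family8, hu, hw, hz, hy]
  generalize √(525 + 70 * √30) = m at *
  generalize √(525 - 70 * √30) = n at *
  generalize √(30 : ℝ) = x at *
  rw [hT]
  refine ⟨RKNMethod.isGauss_of_moments ?_ ?_, ?_, ?_⟩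
  · rw [Fin.strictMono_iff_lt_succ]
    intro i
    fin_cases i <;> simp <;> linarith
  · intro r hr
    simp only [Fin.sum_univ_four, Matrix.cons_val_zero, Matrix.cons_val_one,
      Matrix.cons_val_two, Matrix.cons_val]
    interval_cases r <;> norm_num <;> grind
  -- In `csCoeff_four_nodes` the outer nodes have `α = x`, `ε = ∓m`, the inner ones `α = -x`, `ε =
  -- ∓n`.
  · have hx2' : (-x) ^ 2 = 30 := by rw [neg_sq, hx2]
    have hm2' : (-m) ^ 2 = 525 + 70 * x := by rw [neg_sq, hm2]
    have hn1 : n ^ 2 = 525 + 70 * -x := by rw [hn2]; ring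
    have hn1' : (-n) ^ 2 = 525 + 70 * -x := by rw [neg_sq, hn1]
    clear hT hu hw hz hy hn0 hmn
    intro i j
    fin_cases i <;> fin_cases j <;> simp only [sub_eq_add_neg (35 : ℝ)] <;> simp
    · rw [csCoeff_four_nodes θ hx2 hx2 hm2' hm2']
      grind
    · rw [csCoeff_four_nodes θ hx2 hx2' hm2' hn1']
      grind
    · rw [csCoeff_four_nodes θ hx2 hx2' hm2' hn1]
      grind
    · rw [csCoeff_four_nodes θ hx2 hx2 hm2' hm2]
      grind
    · rw [csCoeff_four_nodes θ hx2' hx2 hn1' hm2']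
      grind
    · rw [csCoeff_four_nodes θ hx2' hx2' hn1' hn1']
      grind
    · rw [csCoeff_four_nodes θ hx2' hx2' hn1' hn1]
      grind
    · rw [csCoeff_four_nodes θ hx2' hx2 hn1' hm2]
      grind
    · rw [csCoeff_four_nodes θ hx2' hx2 hn1 hm2']
      grind
    · rw [csCoeff_four_nodes θ hx2' hx2' hn1 hn1']
      grind
    · rw [csCoeff_four_nodes θ hx2' hx2' hn1 hn1]
      grind
    · rw [csCoeff_four_nodes θ hx2' hx2 hn1 hm2]
      grind
    · rw [csCoeff_four_nodes θ hx2 hx2 hm2 hm2']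
      grind
    · rw [csCoeff_four_nodes θ hx2 hx2' hm2 hn1']
      grind
    · rw [csCoeff_four_nodes θ hx2 hx2' hm2 hn1]
      grind
    · rw [csCoeff_four_nodes θ hx2 hx2 hm2 hm2]
      grind
  · intro i
    fin_cases i <;> simp <;> grind

/-! ### Antisymmetry of the kernels and moments in `σ` -/

theorem csCoeff_two_antisymm (θ τ σ : ℝ) : csCoeff 2 θ τ σ - csCoeff 2 θ σ τ = τ - σ := by
  rw [csCoeff_two, csCoeff_two]
  ring

theorem csCoeff_three_antisymm (θ τ σ : ℝ) : csCoeff 3 θ τ σ - csCoeff 3 θ σ τ = τ - σ := by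
  rw [csCoeff_three, csCoeff_three]
  ring

theorem csCoeff_four_antisymm (θ τ σ : ℝ) : csCoeff 4 θ τ σ - csCoeff 4 θ σ τ = τ - σ := by
  rw [csCoeff_four, csCoeff_four]
  ring

/-- Monomial coefficients of `∑ B m * p m`, `p m` the shifted Legendre polynomials with integer
coefficients. -/
def monomialCoeff (B : Fin 5 → ℝ → ℝ) (n : ℕ) (τ : ℝ) : ℝ :=
  match n with
  | 0 => B 0 τ - B 1 τ + B 2 τ - B 3 τ + B 4 τ
  | 1 => 2 * B 1 τ - 6 * B 2 τ + 12 * B 3 τ - 20 * B 4 τ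
  | 2 => 6 * B 2 τ - 30 * B 3 τ + 90 * B 4 τ
  | 3 => 20 * B 3 τ - 140 * B 4 τ
  | 4 => 70 * B 4 τ
  | _ => 0

/-- Entry `m` of the list is the coefficient of the integer Legendre polynomial `p m` of `σ` in
`csCoeff_two`; the two larger families proceed alike. The parameter multiplies `p (k - 1)`,
orthogonal to `σ ^ r` for `r + 1 < k`, and so disappears from the moments. -/
theorem simplifyingConditions_family4 (θ : ℝ) : (family4 θ).SimplifyingConditions 2 := by
  refine (isGaussDiscretization_family4 θ).simplifyingConditions (csCoeff_two_antisymm θ)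
    (a := monomialCoeff ![fun τ => 1 / 6 + (2 * τ - 1) / 4 + (6 * τ ^ 2 - 6 * τ + 1) / 12,
      fun τ => -1 / 4 + 3 * θ * (2 * τ - 1), fun _ => 1 / 12, fun _ => 0, fun _ => 0])
    (fun τ σ => ?_) (fun r hr τ => ?_)
  · simp [csCoeff_two, Finset.sum_range_succ, monomialCoeff]
    ring
  · obtain rfl : r = 0 := by omega
    simp [Finset.sum_range_succ, monomialCoeff]
    ring

theorem simplifyingConditions_family6 (θ : ℝ) : (family6 θ).SimplifyingConditions 3 := by
  refine (isGaussDiscretization_family6 θ).simplifyingConditions (csCoeff_three_antisymm θ)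
    (a := monomialCoeff ![fun τ => 1 / 6 + (2 * τ - 1) / 4 + (6 * τ ^ 2 - 6 * τ + 1) / 12,
      fun τ => -1 / 4 + (20 * τ ^ 3 - 30 * τ ^ 2 + 12 * τ - 1) / 20 - 3 / 10 * (2 * τ - 1),
      fun τ => 1 / 12 + 5 * θ * (6 * τ ^ 2 - 6 * τ + 1), fun τ => (2 * τ - 1) / 20, fun _ => 0])
    (fun τ σ => ?_) (fun r hr τ => ?_)
  · simp [csCoeff_three, Finset.sum_range_succ, monomialCoeff]
    ring
  · have hr' : r < 2 := by omega
    interval_cases r <;> simp [Finset.sum_range_succ, monomialCoeff] <;> ring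

theorem simplifyingConditions_family8 (θ : ℝ) : (family8 θ).SimplifyingConditions 4 := by
  refine (isGaussDiscretization_family8 θ).simplifyingConditions (csCoeff_four_antisymm θ)
    (a := monomialCoeff ![fun τ => 1 / 6 + (2 * τ - 1) / 4 + (6 * τ ^ 2 - 6 * τ + 1) / 12,
      fun τ => -1 / 4 + (20 * τ ^ 3 - 30 * τ ^ 2 + 12 * τ - 1) / 20 - 3 / 10 * (2 * τ - 1),
      fun τ => 1 / 12 + (70 * τ ^ 4 - 140 * τ ^ 3 + 90 * τ ^ 2 - 20 * τ + 1) / 28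
        - 5 / 42 * (6 * τ ^ 2 - 6 * τ + 1),
      fun τ => (2 * τ - 1) / 20 + 7 * θ * (20 * τ ^ 3 - 30 * τ ^ 2 + 12 * τ - 1),
      fun τ => (6 * τ ^ 2 - 6 * τ + 1) / 28])
    (fun τ σ => ?_) (fun r hr τ => ?_)
  · simp [csCoeff_four, Finset.sum_range_succ, monomialCoeff]
    ring
  · have hr' : r < 3 := by omega
    interval_cases r <;> simp [Finset.sum_range_succ, monomialCoeff] <;> ring

theorem mainTheorem5 (θ : ℝ) :
    ((family4 θ).IsGaussDiscretization (csCoeff 2 θ) ∧ (family4 θ).IsSymplectic ∧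
      (family4 θ).HasOrder 4 ∧ (family4 θ).HasHamOrder 4) ∧
    ((family6 θ).IsGaussDiscretization (csCoeff 3 θ) ∧ (family6 θ).IsSymplectic ∧
      (family6 θ).HasOrder 6 ∧ (family6 θ).HasHamOrder 6) ∧
    ((family8 θ).IsGaussDiscretization (csCoeff 4 θ) ∧ (family8 θ).IsSymplectic ∧
      (family8 θ).HasOrder 8 ∧ (family8 θ).HasHamOrder 8) :=
  ⟨⟨isGaussDiscretization_family4 θ,
      (isGaussDiscretization_family4 θ).isSymplectic (csCoeff_two_antisymm θ),
      (simplifyingConditions_family4 θ).hasOrder (by norm_num),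
      (simplifyingConditions_family4 θ).hasHamOrder (by norm_num)⟩,
    ⟨isGaussDiscretization_family6 θ,
      (isGaussDiscretization_family6 θ).isSymplectic (csCoeff_three_antisymm θ),
      (simplifyingConditions_family6 θ).hasOrder (by norm_num),
      (simplifyingConditions_family6 θ).hasHamOrder (by norm_num)⟩,
    ⟨isGaussDiscretization_family8 θ,
      (isGaussDiscretization_family8 θ).isSymplectic (csCoeff_four_antisymm θ),
      (simplifyingConditions_family8 θ).hasOrder (by norm_num),
      (simplifyingConditions_family8 θ).hasHamOrder (by norm_num)⟩⟩
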